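/- Write $\widehat u(\xi)=\int_{\mathbb R^d}u(x)e^{-2\pi i x\cdot\xi}\,dx$ (extended to $L^2(\mathbb R^d)$ by Plancherel). Let $u:\mathbb R^d\to\mathbb C$ be a non-zero continuous function in $L^2(\mathbb R^d)$ with $\widehat u\in L^1(\mathbb R^d)\cap L^\infty(\mathbb R^d)$, and suppose that $u$ is positive definite, i.e. $k(x,y)=u(x-y)$ is a positive definite kernel: $\sum_{p,q\in S}\overline{X(p)}X(q)k(p,q)\ge 0$ for every finite $S\subset\mathbb R^d$ and every $X:\mathbb R^d\to\mathbb C$. Suppose that for some integer $n>0$ and some real $a>0$ the decay condition $(\mathrm{DC})_{n,a}$ holds: for every $\varepsilon>0$ there is $L_\varepsilon>0$ such that \[ |\widehat u(\xi)|\le L_\varepsilon\,(1+|\xi|^{2n+d+\varepsilon})^{-1}e^{-4\pi a|\xi|}\quad\text{for almost every }\xi\in\mathbb R^d. \] Let $U\subset\mathbb R^d$ be open and let $f:U\to\mathbb R^d$ be any map. Let $H_k$ and $H_{k|_{U^2}}$ be the reproducing kernel Hilbert spaces of $k$ on $\mathbb R^d$ and of its restriction $k|_{U\times U}$ on $U$,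 and let $C_f:H_k\to H_{k|_{U^2}}$, $C_fh=h\circ f$, be the composition operator with domain $\mathcal D(C_f)=\{h\in H_k: h\circ f\in H_{k|_{U^2}}\}$. If $\mathcal D(C_f)=H_k$ and $C_f$ is bounded, then there is a holomorphic map $F:\{z\in\mathbb C^d:|\mathrm{Im}\,z|<a\}\to\mathbb C^d$ such that $F|_U=f$, where $|\cdot|$ is the Euclidean norm and $\mathrm{Im}\,z=(\mathrm{Im}\,z_1,\dots,\mathrm{Im}\,z_d)$. -/

import Mathlib

open MeasureTheory
open scoped FourierTransform ComplexConjugate ComplexOrder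

/-- Positive definite kernels: `∑_{p,q ∈ s} conj (X p) X q k(p,q)` is real and nonnegative for every
finite set `s` and every function `X`. -/
def IsPositiveDefiniteKernel {E : Type*} (k : E → E → ℂ) : Prop :=
  ∀ (s : Finset E) (X : E → ℂ), 0 ≤ ∑ p ∈ s, ∑ q ∈ s, conj (X p) * X q * k p q

/-- A scalar kernel as a matrix of operators on `ℂ`, the form of kernels used by Mathlib. -/
noncomputable def kernelMatrix {E : Type*} (k : E → E → ℂ) : Matrix E E (ℂ →L[ℂ] ℂ) :=
  Matrix.of fun x y => k x y • ContinuousLinearMap.id ℂ ℂ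

namespace IsPositiveDefiniteKernel

theorem restrict {E : Type*} {k : E → E → ℂ} (hk : IsPositiveDefiniteKernel k) (U : Set E) :
    IsPositiveDefiniteKernel fun x y : U => k x y := by
  classical
  intro s X
  have h := hk (s.map (Function.Embedding.subtype _))
    (fun x => if hx : x ∈ U then X ⟨x, hx⟩ else 0)
  simpa [Finset.sum_map] using h

theorem conj_apply {E : Type*} {k : E → E → ℂ} (hk : IsPositiveDefiniteKernel k) (p q : E) :
    conj (k q p) = k p q := by
  classical
  have hd : ∀ x, (k x x).im = 0 := fun x => by
    have h := hk {x} (fun _ => 1)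
    simp only [Finset.sum_singleton, map_one, one_mul] at h
    exact ((Complex.le_def.1 h).2).symm
  rcases eq_or_ne p q with rfl | hpq
  · exact Complex.conj_eq_iff_im.2 (hd p)
  have h1 := (Complex.le_def.1 (hk {p, q} (fun _ => 1))).2
  have h2 := (Complex.le_def.1 (hk {p, q} (fun x => if x = p then 1 else Complex.I))).2
  have hp := hd p
  have hq := hd q
  simp [Finset.sum_pair hpq, hpq.symm] at h1 h2
  apply Complex.ext
  · simp; linarith
  · simp; linarith

theorem posSemidef {E : Type*} {k : E → E → ℂ} (hk : IsPositiveDefiniteKernel k) :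
    (kernelMatrix k).PosSemidef := by
  refine (RKHS.posSemidef_tfae (K := kernelMatrix k).out 0 2).2 (And.intro ?_ fun v => ?_)
  · ext x y
    have h1 : ContinuousLinearMap.id ℂ ℂ = 1 := rfl
    simp [kernelMatrix, Matrix.conjTranspose_apply, hk.conj_apply, h1]
  · have h := (Complex.le_def.1 (hk v.support v)).1
    rw [Finset.sum_comm] at h
    simp only [Finsupp.sum, kernelMatrix, Matrix.of_apply]
    refine h.trans_eq ?_
    rw [Complex.re_sum, map_sum]
    refine Finset.sum_congr rfl fun x _ => ?_
    rw [Complex.re_sum, map_sum]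
    refine Finset.sum_congr rfl fun y _ => ?_
    simp
    ring

/-- The reproducing kernel Hilbert space `H_k` of the positive definite kernel `k`. -/
def Space {E : Type*} {k : E → E → ℂ} (hk : IsPositiveDefiniteKernel k) : Type _ :=
  haveI : Fact (kernelMatrix k).PosSemidef := ⟨hk.posSemidef⟩
  RKHS.OfKernel (kernelMatrix k)

noncomputable instance {E : Type*} {k : E → E → ℂ} (hk : IsPositiveDefiniteKernel k) :
    NormedAddCommGroup hk.Space :=
  haveI : Fact (kernelMatrix k).PosSemidef := ⟨hk.posSemidef⟩
  inferInstanceAs (NormedAddCommGroup (RKHS.OfKernel (kernelMatrix k)))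

noncomputable instance {E : Type*} {k : E → E → ℂ} (hk : IsPositiveDefiniteKernel k) :
    InnerProductSpace ℂ hk.Space :=
  haveI : Fact (kernelMatrix k).PosSemidef := ⟨hk.posSemidef⟩
  inferInstanceAs (InnerProductSpace ℂ (RKHS.OfKernel (kernelMatrix k)))

instance {E : Type*} {k : E → E → ℂ} (hk : IsPositiveDefiniteKernel k) :
    CompleteSpace hk.Space :=
  haveI : Fact (kernelMatrix k).PosSemidef := ⟨hk.posSemidef⟩
  inferInstanceAs (CompleteSpace (RKHS.OfKernel (kernelMatrix k)))

/-- Elements of `H_k` are functions on `E`, and point evaluations are continuous. -/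
noncomputable instance {E : Type*} {k : E → E → ℂ} (hk : IsPositiveDefiniteKernel k) :
    RKHS ℂ hk.Space E ℂ :=
  haveI : Fact (kernelMatrix k).PosSemidef := ⟨hk.posSemidef⟩
  inferInstanceAs (RKHS ℂ (RKHS.OfKernel (kernelMatrix k)) E ℂ)

/-- The reproducing kernel of `H_k` is `k`. -/
theorem kernel_space {E : Type*} {k : E → E → ℂ} (hk : IsPositiveDefiniteKernel k) :
    RKHS.kernel hk.Space = kernelMatrix k :=
  haveI : Fact (kernelMatrix k).PosSemidef := ⟨hk.posSemidef⟩
  RKHS.OfKernel.kernel_ofKernel (K := kernelMatrix k)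

/-- The function `k(·,y)` belongs to `H_k` and has the reproducing property `⟪k(·,y), h⟫ = h y`. -/
theorem reproducing {E : Type*} {k : E → E → ℂ} (hk : IsPositiveDefiniteKernel k) (y : E) :
    ∃ g : hk.Space, (∀ x, g x = k x y) ∧ ∀ h : hk.Space, inner ℂ g h = h y := by
  refine ⟨RKHS.kerFun hk.Space y 1, fun x => ?_, fun h => ?_⟩
  · rw [RKHS.kerFun_apply, kernel_space]
    simp [kernelMatrix]
  · rw [RKHS.kerFun_inner]
    simp

end IsPositiveDefiniteKernel

/-- The composition operator `C_f : H → H'`, `C_f h = h ∘ f`, for a map `f : E → F`, where `H` and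
`H'` are reproducing kernel Hilbert spaces on `F` and `E`. It is a partially defined linear map
with domain `{h ∈ H : h ∘ f ∈ H'}`. -/
noncomputable def compositionOperator {E F : Type*} (H H' : Type*)
    [NormedAddCommGroup H] [InnerProductSpace ℂ H] [RKHS ℂ H F ℂ]
    [NormedAddCommGroup H'] [InnerProductSpace ℂ H'] [RKHS ℂ H' E ℂ]
    (f : E → F) : H →ₗ.[ℂ] H' where
  domain :=
    { carrier := {h | ∃ g : H', ∀ x, g x = h (f x)}
      add_mem' := by
        rintro h₁ h₂ ⟨g₁, hg₁⟩ ⟨g₂, hg₂⟩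
        exact ⟨g₁ + g₂, fun x => by simp [hg₁, hg₂]⟩
      zero_mem' := ⟨0, fun x => by simp⟩
      smul_mem' := by
        rintro c h ⟨g, hg⟩
        exact ⟨c • g, fun x => by simp [hg]⟩ }
  toFun :=
    { toFun := fun h => Classical.choose h.2
      map_add' := fun h₁ h₂ => RKHS.ext fun x => by
        have e := Classical.choose_spec (h₁ + h₂).2 x
        have e₁ := Classical.choose_spec h₁.2 x
        have e₂ := Classical.choose_spec h₂.2 x
        rw [e]
        simp [e₁, e₂]
      map_smul' := fun c h => RKHS.ext fun x => by
        have e := Classical.choose_spec (c • h).2 x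
        have e₁ := Classical.choose_spec h.2 x
        rw [e]
        simp [e₁] }

theorem compositionOperator_apply {E F : Type*} {H H' : Type*}
    [NormedAddCommGroup H] [InnerProductSpace ℂ H] [RKHS ℂ H F ℂ]
    [NormedAddCommGroup H'] [InnerProductSpace ℂ H'] [RKHS ℂ H' E ℂ]
    (f : E → F) (h : (compositionOperator H H' f).domain) (x : E) :
    (compositionOperator H H' f h) x = (h : H) (f x) :=
  Classical.choose_spec h.2 x

/-- A partially defined linear operator is bounded if `‖T h‖ ≤ C ‖h‖` on its domain for some `C`. -/
def IsBoundedOperator {H H' : Type*} [NormedAddCommGroup H] [NormedSpace ℂ H]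
    [NormedAddCommGroup H'] [NormedSpace ℂ H'] (T : H →ₗ.[ℂ] H') : Prop :=
  ∃ C : ℝ, ∀ h : T.domain, ‖T h‖ ≤ C * ‖(h : H)‖

/-- The Fourier transform (kernel `e^{-2πi x·ξ}`) of a function in `L²(ℝ^d)`, as an element of
`L²(ℝ^d)`. -/
noncomputable def fourierL2 {d : ℕ} (u : EuclideanSpace ℝ (Fin d) → ℂ) (hu : MemLp u 2 volume) :
    Lp (α := EuclideanSpace ℝ (Fin d)) ℂ 2 :=
  𝓕 (hu.toLp u)

/-- The decay condition `(DC)_{n,a}`, as a condition on the Fourier transform `w` of `u`. -/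
def DecayCondition {d : ℕ} (n : ℕ) (a : ℝ) (w : EuclideanSpace ℝ (Fin d) → ℂ) : Prop :=
  ∀ ε : ℝ, 0 < ε → ∃ L : ℝ, 0 < L ∧ ∀ᵐ ξ ∂(volume : Measure (EuclideanSpace ℝ (Fin d))),
    ‖w ξ‖ ≤ L * (1 + ‖ξ‖ ^ (2 * (n : ℝ) + (d : ℝ) + ε))⁻¹ * Real.exp (-(4 * Real.pi * a * ‖ξ‖))

/-- The coordinatewise imaginary part `ℂ^d → ℝ^d`. -/
noncomputable def imVec {d : ℕ} (z : EuclideanSpace ℂ (Fin d)) : EuclideanSpace ℝ (Fin d) :=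
  WithLp.toLp 2 fun i => (z i).im

/-- The inclusion `ℝ^d ⊂ ℂ^d`. -/
noncomputable def complexVec {d : ℕ} (x : EuclideanSpace ℝ (Fin d)) : EuclideanSpace ℂ (Fin d) :=
  WithLp.toLp 2 fun i => (x i : ℂ)

/-- The tube `{z ∈ ℂ^d : |Im z| < a}`, with the Euclidean norm. -/
def tube (d : ℕ) (a : ℝ) : Set (EuclideanSpace ℂ (Fin d)) :=
  {z | ‖imVec z‖ < a}

/-!
The map `f` is recovered from the functions `x ↦ e^{2πi f(x)·ξ}`, which are shown to extend to the
tube for almost every frequency `ξ` in the support of `û`.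

**From the composition operator to `L²(μ)`.** Since `u` is positive definite, `û ≥ 0` almost
everywhere (`fourierL2_nonneg`): the integral of `û |ψ̂|²` is the squared norm of `∫ ψ(y) k(·,y) dy`
in `H_k`. With `μ = û dξ` one has `u(x) = ∫ e^{2πi x·ξ} dμ(ξ)`, and the decay condition gives `μ` the
exponential moment `∫ e^{4πa|ξ|} dμ < ∞` (`exists_spectralMeasure`). The adjoint of `C_f` sends
`k(·,q)` to `k(·,f(q))`, so its boundedness yields a bounded operator `S` on `L²(μ)` that sends
`e_q(ξ) = e^{2πi q·ξ}` to `e_{f(q)}` for `q ∈ U` (`exists_operator_charL2`).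

**Extension for almost every frequency.** For `z` in the tube `e_z` belongs to `L²(μ)`. Around a real
point `x` its expansion in monomials of `z - x` has coefficients whose squared norms in degree `n`
sum to `O(a^{-2n})`; the same holds for the images under `S`, so that for almost every `ξ` the
power series of `(S e_z)(ξ)` converges for `|z - x| < a`. The balls of radius `a` with real
centres cover the tube, and the series for different centres represent the same element of `L²(μ)`,
hence glue (`ae_exists_isExtension`).

**All frequencies.** The set `P` of the `ξ` for which the extension exists is a semigroup, and has
positive measure, so by the theorem of Steinhaus it contains a ball. If `ξ` and `(1 + 1/N) ξ` lie
in this ball, the extensions `g` and `h` satisfy `h^N = g^{N+1}`, hence `N` divides the order of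
every zero of `g` along a line; as this holds for all large `N`, there are no zeros. Then `-ξ ∈ P` as
well, and `P = ℝ^d` (`forall_exists_isExtension`).

**Logarithms.** The tube is simply connected, so the extensions have logarithms. The logarithm for
`ξ`, normalised at one point, is `N` times the one for `ξ/N`; its value at `x` therefore differs
from `2πi f(x)·ξ` by an element of `2πi N ℤ` for every `N`, that is, not at all
(`exists_extension_inner`). For the coordinate vectors `ξ` this is the extension of `f`.

The almost everywhere statements allow only countably many points `x` at a time. As `f` is not known
to be continuous, each further point of `U` is added to a countable dense subset, and the identity
theorem `eqOn_tube` shows that the resulting extension does not depend on it.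
-/

/-! ### Geometry of the tube and the identity theorem -/

section Tube

variable {d : ℕ}

@[simp] lemma imVec_apply (z : EuclideanSpace ℂ (Fin d)) (i : Fin d) : imVec z i = (z i).im := rfl

@[simp] lemma complexVec_apply (x : EuclideanSpace ℝ (Fin d)) (i : Fin d) :
    complexVec x i = (x i : ℂ) := rfl

/-- The coordinatewise real part `ℂ^d → ℝ^d`. -/
noncomputable def reVec (z : EuclideanSpace ℂ (Fin d)) : EuclideanSpace ℝ (Fin d) :=
  WithLp.toLp 2 fun i => (z i).re

@[simp] lemma reVec_apply (z : EuclideanSpace ℂ (Fin d)) (i : Fin d) : reVec z i = (z i).re := rfl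

lemma continuous_imVec : Continuous (imVec (d := d)) := by
  unfold imVec; fun_prop

lemma continuous_reVec : Continuous (reVec (d := d)) := by
  unfold reVec; fun_prop

lemma continuous_complexVec : Continuous (complexVec (d := d)) := by
  unfold complexVec; fun_prop

lemma imVec_add (z w : EuclideanSpace ℂ (Fin d)) : imVec (z + w) = imVec z + imVec w := by
  ext i; simp

lemma imVec_ofReal_smul (t : ℝ) (z : EuclideanSpace ℂ (Fin d)) :
    imVec ((t : ℂ) • z) = t • imVec z := by
  ext i; simp

@[simp] lemma imVec_complexVec (x : EuclideanSpace ℝ (Fin d)) : imVec (complexVec x) = 0 := by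
  ext i; simp

@[simp] lemma reVec_complexVec (x : EuclideanSpace ℝ (Fin d)) : reVec (complexVec x) = x := by
  ext i; simp

lemma complexVec_reVec_add (z : EuclideanSpace ℂ (Fin d)) :
    complexVec (reVec z) + Complex.I • complexVec (imVec z) = z := by
  ext i
  simp [mul_comm Complex.I, Complex.re_add_im]

lemma isOpen_tube (a : ℝ) : IsOpen (tube d a) :=
  isOpen_lt continuous_imVec.norm continuous_const

lemma convex_tube (a : ℝ) : Convex ℝ (tube d a) := by
  intro z hz w hw s t hs ht hst
  have e : imVec (s • z + t • w) = s • imVec z + t • imVec w := by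
    rw [imVec_add, ← imVec_ofReal_smul, ← imVec_ofReal_smul]; simp
  have := (convex_ball (0 : EuclideanSpace ℝ (Fin d)) a)
    (x := imVec z) (by simpa [tube] using hz) (y := imVec w) (by simpa [tube] using hw) hs ht hst
  simpa [tube, e] using this

lemma complexVec_mem_tube {a : ℝ} (ha : 0 < a) (x : EuclideanSpace ℝ (Fin d)) :
    complexVec x ∈ tube d a := by
  simpa [tube] using ha

/-- The parameters `t` for which the point `p + t v` of a complex line lies in the tube. -/
def lineTube (a : ℝ) (p v : EuclideanSpace ℂ (Fin d)) : Set ℂ :=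
  {t | p + t • v ∈ tube d a}

lemma isOpen_lineTube (a : ℝ) (p v : EuclideanSpace ℂ (Fin d)) : IsOpen (lineTube a p v) :=
  (isOpen_tube a).preimage (by fun_prop)

lemma isPreconnected_lineTube (a : ℝ) (p v : EuclideanSpace ℂ (Fin d)) :
    IsPreconnected (lineTube a p v) := by
  refine Convex.isPreconnected fun t ht s hs α β hα hβ hαβ => ?_
  have := convex_tube a ht hs hα hβ hαβ
  have e : p + (α • t + β • s) • v = α • (p + t • v) + β • (p + s • v) := by
    have : p = (α + β) • p := by rw [hαβ, one_smul]
    nth_rw 1 [this]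
    simp only [add_smul, smul_add, smul_assoc]
    abel
  change p + (α • t + β • s) • v ∈ tube d a
  rw [e]
  exact this

lemma analyticOnNhd_lineTube {a : ℝ} {h : EuclideanSpace ℂ (Fin d) → ℂ}
    (hh : DifferentiableOn ℂ h (tube d a)) (p v : EuclideanSpace ℂ (Fin d)) :
    AnalyticOnNhd ℂ (fun t : ℂ => h (p + t • v)) (lineTube a p v) := by
  apply DifferentiableOn.analyticOnNhd _ (isOpen_lineTube a p v)
  exact hh.comp (by fun_prop) (fun t ht => ht)

lemma eq_zero_of_eventually_eq_zero_on_line {a : ℝ} {h : EuclideanSpace ℂ (Fin d) → ℂ}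
    (hh : DifferentiableOn ℂ h (tube d a)) {p v : EuclideanSpace ℂ (Fin d)} (hp : p ∈ tube d a)
    (h0 : ∀ᶠ t : ℝ in nhds 0, h (p + (t : ℂ) • v) = 0) {s : ℂ} (hs : p + s • v ∈ tube d a) :
    h (p + s • v) = 0 := by
  have key := (analyticOnNhd_lineTube hh p v).eqOn_zero_of_preconnected_of_frequently_eq_zero
    (isPreconnected_lineTube a p v) (z₀ := 0) (by simpa [lineTube] using hp) ?_
  · exact key hs
  have h1 : ∃ᶠ t : ℝ in nhdsWithin 0 {0}ᶜ, h (p + (t : ℂ) • v) = 0 :=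
    (h0.filter_mono nhdsWithin_le_nhds).frequently
  have h2 : Filter.Tendsto (fun t : ℝ => (t : ℂ)) (nhdsWithin 0 {0}ᶜ) (nhdsWithin 0 {0}ᶜ) := by
    apply tendsto_nhdsWithin_of_tendsto_nhds_of_eventually_within
    · have : Filter.Tendsto (fun t : ℝ => (t : ℂ)) (nhds 0) (nhds ((0 : ℝ) : ℂ)) :=
        Complex.continuous_ofReal.tendsto 0
      simpa using this.mono_left nhdsWithin_le_nhds
    · filter_upwards [self_mem_nhdsWithin] with t ht
      simpa using ht
  exact h2.frequently h1

/-- A holomorphic function on the tube that vanishes on a nonempty open set of real points vanishes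
identically: along the complex lines in real directions through those points, and then along the
complex lines through one of them. -/
lemma eqOn_zero_tube {a : ℝ} {h : EuclideanSpace ℂ (Fin d) → ℂ}
    (hh : DifferentiableOn ℂ h (tube d a)) {U : Set (EuclideanSpace ℝ (Fin d))} (hU : IsOpen U)
    (hne : U.Nonempty) (h0 : ∀ x ∈ U, h (complexVec x) = 0) :
    ∀ z ∈ tube d a, h z = 0 := by
  have line : ∀ (p v : EuclideanSpace ℂ (Fin d)), reVec p ∈ U →
      ∀ᶠ t : ℝ in nhds 0, reVec (p + (t : ℂ) • v) ∈ U := by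
    intro p v hp
    have : Filter.Tendsto (fun t : ℝ => reVec (p + (t : ℂ) • v)) (nhds 0)
        (nhds (reVec (p + ((0 : ℝ) : ℂ) • v))) := by
      have : Continuous (fun t : ℝ => reVec (p + (t : ℂ) • v)) :=
        continuous_reVec.comp (by fun_prop)
      exact this.tendsto 0
    apply this
    simpa using hU.mem_nhds hp
  have step1 : ∀ z ∈ tube d a, reVec z ∈ U → h z = 0 := by
    intro z hz hzU
    have ha : 0 < a := lt_of_le_of_lt (norm_nonneg _) hz
    rw [← complexVec_reVec_add z] at hz ⊢
    refine eq_zero_of_eventually_eq_zero_on_line hh (complexVec_mem_tube ha _) ?_ hz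
    filter_upwards [line (complexVec (reVec z)) (complexVec (imVec z)) (by simpa using hzU)]
      with t ht
    have e : complexVec (reVec z) + (t : ℂ) • complexVec (imVec z)
        = complexVec (reVec (complexVec (reVec z) + (t : ℂ) • complexVec (imVec z))) := by
      ext i; simp
    rw [e]
    exact h0 _ ht
  intro z hz
  have ha : 0 < a := lt_of_le_of_lt (norm_nonneg _) hz
  obtain ⟨x, hx⟩ := hne
  have e : complexVec x + (1 : ℂ) • (z - complexVec x) = z := by simp
  rw [← e] at hz ⊢
  refine eq_zero_of_eventually_eq_zero_on_line hh (complexVec_mem_tube ha _) ?_ hz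
  have hs : ∀ᶠ t : ℝ in nhds 0, complexVec x + (t : ℂ) • (z - complexVec x) ∈ tube d a := by
    have : Continuous (fun t : ℝ => complexVec x + (t : ℂ) • (z - complexVec x)) := by fun_prop
    refine this.continuousAt.eventually ((isOpen_tube a).mem_nhds ?_)
    simpa using complexVec_mem_tube ha x
  filter_upwards [line (complexVec x) (z - complexVec x) (by simpa using hx), hs] with t ht ht'
  exact step1 _ ht' ht

/-- Identity theorem: a holomorphic function on the tube is determined by its values at a set of real
points that is dense in a nonempty open subset of `ℝ^d`. -/
lemma eqOn_tube {a : ℝ} {g h : EuclideanSpace ℂ (Fin d) → ℂ}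
    (hg : DifferentiableOn ℂ g (tube d a)) (hh : DifferentiableOn ℂ h (tube d a))
    {U D : Set (EuclideanSpace ℝ (Fin d))} (hU : IsOpen U)
    (hne : U.Nonempty) (hD : U ⊆ closure D)
    (h0 : ∀ x ∈ D, g (complexVec x) = h (complexVec x)) :
    ∀ z ∈ tube d a, g z = h z := by
  intro z hz
  have ha : 0 < a := lt_of_le_of_lt (norm_nonneg _) hz
  have hcont : ∀ {k : EuclideanSpace ℂ (Fin d) → ℂ}, DifferentiableOn ℂ k (tube d a) →
      Continuous fun x => k (complexVec x) := fun hk =>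
    continuous_iff_continuousAt.2 fun x =>
      ((hk.continuousOn.continuousAt ((isOpen_tube a).mem_nhds (complexVec_mem_tube ha x)))).comp
        continuous_complexVec.continuousAt
  have h1 : ∀ x ∈ U, g (complexVec x) = h (complexVec x) := fun x hx =>
    closure_minimal (fun y hy => h0 y hy)
      (isClosed_eq (hcont hg) (hcont hh)) (hD hx)
  have := eqOn_zero_tube (hg.sub hh) hU hne (fun x hx => by simp [h1 x hx]) z hz
  exact sub_eq_zero.1 this

/-- On the complex line through `p` and a zero of `g`, the order `m` of the zero is finite, and
`h ^ N = g ^ (N + 1)` makes it divisible by `N`, for arbitrarily large `N`. -/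
lemma ne_zero_of_pow_eq {a : ℝ} {g : EuclideanSpace ℂ (Fin d) → ℂ}
    (hg : DifferentiableOn ℂ g (tube d a))
    (hpow : ∀ N₀ : ℕ, ∃ N ≥ N₀, ∃ h : EuclideanSpace ℂ (Fin d) → ℂ,
      DifferentiableOn ℂ h (tube d a) ∧ ∀ z ∈ tube d a, h z ^ N = g z ^ (N + 1))
    {p : EuclideanSpace ℂ (Fin d)} (hp : p ∈ tube d a) (hgp : g p ≠ 0) :
    ∀ z ∈ tube d a, g z ≠ 0 := by
  intro z hz hgz
  set v := p - z with hv
  have h0 : (0 : ℂ) ∈ lineTube a z v := by simpa [lineTube] using hz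
  have h1 : (1 : ℂ) ∈ lineTube a z v := by simpa [lineTube, hv] using hp
  have hga := analyticOnNhd_lineTube hg z v
  have hfin : analyticOrderAt (fun t : ℂ => g (z + t • v)) 0 ≠ ⊤ := by
    intro htop
    rw [analyticOrderAt_eq_top] at htop
    have := hga.eqOn_zero_of_preconnected_of_eventuallyEq_zero (isPreconnected_lineTube a z v) h0
      htop h1
    simp [hv] at this
    exact hgp this
  obtain ⟨m, hm⟩ := ENat.ne_top_iff_exists.1 hfin
  have hm0 : m ≠ 0 := by
    intro h
    rw [h, Nat.cast_zero, eq_comm, (hga 0 h0).analyticOrderAt_eq_zero] at hm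
    simp [hgz] at hm
  obtain ⟨N, hN, h, hh, hhg⟩ := hpow (m + 1)
  have hha := analyticOnNhd_lineTube hh z v
  have hev : (fun t : ℂ => h (z + t • v)) ^ N =ᶠ[nhds 0]
      (fun t : ℂ => g (z + t • v)) ^ (N + 1) := by
    filter_upwards [(isOpen_lineTube a z v).mem_nhds h0] with t ht
    simpa using hhg _ ht
  have ho := analyticOrderAt_congr hev
  rw [analyticOrderAt_pow (hha 0 h0), analyticOrderAt_pow (hga 0 h0), ← hm] at ho
  have hk : analyticOrderAt (fun t : ℂ => h (z + t • v)) 0 ≠ ⊤ := by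
    intro htop
    rw [htop] at ho
    have hN0 : N ≠ 0 := by omega
    rw [nsmul_eq_mul, ENat.mul_top (by exact_mod_cast hN0)] at ho
    exact ENat.natCast_ne_top ((N + 1) * m) (by rw [ho]; push_cast; simp)
  obtain ⟨k, hk⟩ := ENat.ne_top_iff_exists.1 hk
  rw [← hk, nsmul_eq_mul, nsmul_eq_mul] at ho
  have ho' : N * k = (N + 1) * m := by exact_mod_cast ho
  have hdvd : N ∣ m := by
    have : N ∣ (N + 1) * m := ⟨k, ho'.symm⟩
    exact (Nat.Coprime.dvd_mul_left (by simp)).1 this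
  have := Nat.le_of_dvd (Nat.pos_of_ne_zero hm0) hdvd
  omega

/-- A nonvanishing holomorphic function on the tube has a holomorphic logarithm. -/
lemma exists_log_tube {a : ℝ} (ha : 0 < a) {g : EuclideanSpace ℂ (Fin d) → ℂ}
    (hg : DifferentiableOn ℂ g (tube d a)) (hne : ∀ z ∈ tube d a, g z ≠ 0) :
    ∃ l : EuclideanSpace ℂ (Fin d) → ℂ, DifferentiableOn ℂ l (tube d a) ∧
      ∀ z ∈ tube d a, Complex.exp (l z) = g z := by
  have hsc : IsSimplyConnected (tube d a) := by
    have := (convex_tube (d := d) a).contractibleSpace ⟨complexVec 0, complexVec_mem_tube ha 0⟩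
    exact (inferInstance : SimplyConnectedSpace (tube d a))
  obtain ⟨l, hl, hexp⟩ := Complex.exists_continuousOn_eqOn_exp_comp hsc (isOpen_tube a)
    hg.continuousOn (by rintro ⟨z, hz, h⟩; exact hne z hz h)
  refine ⟨l, fun z hz => ?_, fun z hz => hexp hz⟩
  have hnhds := (isOpen_tube (d := d) a).mem_nhds hz
  have hlc : ContinuousAt l z := hl.continuousAt hnhds
  have hgd : DifferentiableAt ℂ g z := hg.differentiableAt hnhds
  -- near `z`, `l = l z + log (g · exp (- l z))` with the principal branch of the logarithm
  have hev : (fun w => l z + Complex.log (g w * Complex.exp (-l z))) =ᶠ[nhds z] l := by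
    have him : ∀ᶠ w in nhds z, |(l w - l z).im| < Real.pi := by
      have : Filter.Tendsto (fun w => |(l w - l z).im|) (nhds z) (nhds |(l z - l z).im|) :=
        ((Complex.continuous_im.tendsto _).comp (hlc.sub continuousAt_const)).abs
      exact this.eventually_lt_const (by simpa using Real.pi_pos)
    filter_upwards [him, hnhds] with w hw hwt
    have e : g w * Complex.exp (-l z) = Complex.exp (l w - l z) := by
      rw [← hexp hwt, Function.comp, ← Complex.exp_add, sub_eq_add_neg]
    rw [e, Complex.log_exp (abs_lt.1 hw).1 (abs_lt.1 hw).2.le]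
    ring
  refine (DifferentiableAt.congr_of_eventuallyEq ?_ hev.symm).differentiableWithinAt
  refine (DifferentiableAt.clog (hgd.mul_const _) ?_).const_add _
  have : g z * Complex.exp (-l z) = 1 := by
    rw [← hexp hz, Function.comp, ← Complex.exp_add]; simp
  rw [this]; exact Complex.one_mem_slitPlane

end Tube

/-! ### Characters that extend to the tube -/

section Characters

variable {d : ℕ}

/-- The sumset of a set of positive measure has nonempty interior: some intersection
`A = E ∩ (c - E)` has positive measure, and `E + E ⊇ A + (c - A) = c + (A - A)`, to which the
theorem of Steinhaus applies. -/
lemma exists_ball_subset_add {E : Set (EuclideanSpace ℝ (Fin d))} (hE : MeasurableSet E)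
    (hpos : 0 < volume E) : ∃ c : EuclideanSpace ℝ (Fin d), ∃ r > 0,
      ∀ ξ ∈ Metric.ball c r, ∃ x ∈ E, ∃ y ∈ E, ξ = x + y := by
  obtain ⟨c, hc⟩ : ∃ c, 0 < volume {x | x ∈ E ∧ c - x ∈ E} := by
    by_contra! hcon
    have hS : MeasurableSet {q : EuclideanSpace ℝ (Fin d) × EuclideanSpace ℝ (Fin d) |
        q.2 ∈ E ∧ q.1 - q.2 ∈ E} :=
      (measurable_snd hE).inter ((measurable_fst.sub measurable_snd) hE)
    have h1 : ∀ᵐ c, ∀ᵐ x, ¬ (x ∈ E ∧ c - x ∈ E) :=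
      Filter.Eventually.of_forall fun c => by
        simpa [ae_iff] using hcon c
    have h2 : ∀ᵐ x, ∀ᵐ c, ¬ (x ∈ E ∧ c - x ∈ E) :=
      (Measure.ae_ae_comm (p := fun c x => ¬ (x ∈ E ∧ c - x ∈ E)) hS.compl).1 h1
    have h3 : ∀ᵐ x, x ∉ E := by
      filter_upwards [h2] with x hx hxE
      simp only [hxE, true_and, ae_iff, not_not] at hx
      have : {c | c - x ∈ E} = (fun c => c + -x) ⁻¹' E := by ext; simp [sub_eq_add_neg]
      rw [this, measure_preimage_add_right] at hx
      exact hpos.ne' hx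
    exact hpos.ne' (by simpa [ae_iff] using h3)
  set A := {x | x ∈ E ∧ c - x ∈ E} with hA
  have hAm : MeasurableSet A := hE.inter ((measurable_const.sub measurable_id) hE)
  obtain ⟨r, hr, hball⟩ := Metric.mem_nhds_iff.1
    (Measure.sub_mem_nhds_zero_of_addHaar_pos volume A hAm hc)
  refine ⟨c, r, hr, fun ξ hξ => ?_⟩
  obtain ⟨x, hx, y, hy, hxy⟩ := hball (show ξ - c ∈ Metric.ball 0 r by
    simpa [dist_eq_norm] using hξ)
  refine ⟨x, hx.1, c - y, hy.2, ?_⟩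
  simp only at hxy
  rw [add_sub, add_comm x c, ← add_sub, hxy]; abel

/-- The character `x ↦ e^{2πi x·ξ}`. -/
noncomputable def character (ξ x : EuclideanSpace ℝ (Fin d)) : ℂ :=
  Complex.exp ((2 * Real.pi * inner ℝ x ξ : ℝ) * Complex.I)

lemma character_add (ξ η x : EuclideanSpace ℝ (Fin d)) :
    character (ξ + η) x = character ξ x * character η x := by
  rw [character, character, character, ← Complex.exp_add, inner_add_right]
  congr 1; push_cast; ring

lemma character_nsmul (n : ℕ) (ξ x : EuclideanSpace ℝ (Fin d)) :
    character ((n : ℝ) • ξ) x = character ξ x ^ n := by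
  rw [character, character, ← Complex.exp_nat_mul, inner_smul_right]
  congr 1; push_cast; ring

lemma character_neg (ξ x : EuclideanSpace ℝ (Fin d)) :
    character (-ξ) x = (character ξ x)⁻¹ := by
  rw [character, character, ← Complex.exp_neg, inner_neg_right]
  congr 1; push_cast; ring

lemma character_ne_zero (ξ x : EuclideanSpace ℝ (Fin d)) : character ξ x ≠ 0 :=
  Complex.exp_ne_zero _

/-- `g` is a holomorphic extension to the tube of the function `x ↦ e^{2πi f(x)·ξ}` on `D`. -/
structure IsExtension (a : ℝ) (D : Set (EuclideanSpace ℝ (Fin d)))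
    (f : EuclideanSpace ℝ (Fin d) → EuclideanSpace ℝ (Fin d)) (ξ : EuclideanSpace ℝ (Fin d))
    (g : EuclideanSpace ℂ (Fin d) → ℂ) : Prop where
  differentiableOn : DifferentiableOn ℂ g (tube d a)
  eq : ∀ x ∈ D, g (complexVec x) = character ξ (f x)

variable {a : ℝ} {D : Set (EuclideanSpace ℝ (Fin d))}
  {f : EuclideanSpace ℝ (Fin d) → EuclideanSpace ℝ (Fin d)}

lemma IsExtension.mul {ξ η : EuclideanSpace ℝ (Fin d)} {g h : EuclideanSpace ℂ (Fin d) → ℂ}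
    (hg : IsExtension a D f ξ g) (hh : IsExtension a D f η h) :
    IsExtension a D f (ξ + η) (fun z => g z * h z) :=
  ⟨hg.1.mul hh.1, fun x hx => by rw [hg.2 x hx, hh.2 x hx, character_add]⟩

/-- If the exponents for which `x ↦ e^{2πi f(x)·ξ}` extends to the tube contain a set of positive
measure, then every exponent occurs, with a nonvanishing extension. The exponents form a semigroup,
which contains a ball; for `ξ` in the ball also `(1 + 1/N) ξ` is in it for large `N`, which forces
the extension for `ξ` to be free of zeros. So `-ξ` is an exponent, and the exponents contain a
neighbourhood of the origin. -/
lemma forall_exists_isExtension (ha : 0 < a) {U : Set (EuclideanSpace ℝ (Fin d))} (hU : IsOpen U)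
    (hne : U.Nonempty) (hD : U ⊆ closure D)
    {E : Set (EuclideanSpace ℝ (Fin d))} (hE : MeasurableSet E) (hpos : 0 < volume E)
    (hext : ∀ ξ ∈ E, ∃ g, IsExtension a D f ξ g) (ξ : EuclideanSpace ℝ (Fin d)) :
    ∃ g, IsExtension a D f ξ g ∧ ∀ z ∈ tube d a, g z ≠ 0 := by
  obtain ⟨c, r, hr, hball⟩ := exists_ball_subset_add hE hpos
  have hball' : ∀ η ∈ Metric.ball c r, ∃ g, IsExtension a D f η g := by
    intro η hη
    obtain ⟨x, hx, y, hy, rfl⟩ := hball η hη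
    obtain ⟨g, hg⟩ := hext x hx
    obtain ⟨h, hh⟩ := hext y hy
    exact ⟨_, hg.mul hh⟩
  obtain ⟨x₀, hx₀⟩ : D.Nonempty := closure_nonempty_iff.1 (hne.mono hD)
  have hnz : ∀ η ∈ Metric.ball c r, ∃ g, IsExtension a D f η g ∧ ∀ z ∈ tube d a, g z ≠ 0 := by
    intro η hη
    obtain ⟨g, hg⟩ := hball' η hη
    refine ⟨g, hg, ne_zero_of_pow_eq hg.1 ?_ (complexVec_mem_tube ha x₀)
      (by rw [hg.2 x₀ hx₀]; exact character_ne_zero _ _)⟩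
    have hlim : Filter.Tendsto (fun N : ℕ => η + (1 / (N : ℝ)) • η) Filter.atTop (nhds η) := by
      simpa using (tendsto_one_div_atTop_nhds_zero_nat (𝕜 := ℝ)).smul_const η |>.const_add η
    intro N₀
    obtain ⟨N, hN, hN0, hNb⟩ := ((Filter.eventually_ge_atTop N₀).and
      ((Filter.eventually_gt_atTop 0).and
        (hlim.eventually (Metric.isOpen_ball.mem_nhds hη)))).exists
    obtain ⟨h, hh⟩ := hball' _ hNb
    refine ⟨N, hN, h, hh.1, eqOn_tube (hh.1.pow N) (hg.1.pow (N + 1)) hU hne hD ?_⟩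
    intro x hx
    have hN' : (N : ℝ) ≠ 0 := by positivity
    simp only [hh.2 x hx, hg.2 x hx]
    rw [← character_nsmul, ← character_nsmul]
    congr 1
    rw [smul_add, smul_smul, mul_one_div_cancel hN', Nat.cast_add, add_smul]; simp
  -- `ξ = N (η - c)` with `η = c + ξ / N` in the ball
  have hlim : Filter.Tendsto (fun N : ℕ => c + (1 / (N : ℝ)) • ξ) Filter.atTop (nhds c) := by
    simpa using (tendsto_one_div_atTop_nhds_zero_nat (𝕜 := ℝ)).smul_const ξ |>.const_add c
  obtain ⟨N, hN0, hNb⟩ := ((Filter.eventually_gt_atTop 0).and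
    (hlim.eventually (Metric.ball_mem_nhds c hr))).exists
  obtain ⟨g, hg, hg0⟩ := hnz _ hNb
  obtain ⟨h, hh, hh0⟩ := hnz c (Metric.mem_ball_self hr)
  refine ⟨fun z => (g z * (h z)⁻¹) ^ N, ⟨?_, fun x hx => ?_⟩, fun z hz =>
    pow_ne_zero _ (mul_ne_zero (hg0 z hz) (inv_ne_zero (hh0 z hz)))⟩
  · exact (hg.1.mul (hh.1.inv hh0)).pow N
  · have hN' : (N : ℝ) ≠ 0 := by positivity
    rw [hg.2 x hx, hh.2 x hx, ← character_neg, ← character_add, ← character_nsmul]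
    congr 1
    rw [add_neg_eq_iff_eq_add.2 (add_comm _ _), smul_smul, mul_one_div_cancel hN', one_smul]

/-- Taking logarithms: if `x ↦ e^{2πi f(x)·ξ}` has a nonvanishing extension for every `ξ`, then the
scalar function `x ↦ f(x)·ξ` itself extends. The normalised logarithm of the extension for `ξ`
is `N` times the one for `ξ/N`, so that its deviation from `2πi f(x)·ξ` is a multiple of `2πi N` for
every `N`; no continuity of `f` is needed. -/
lemma exists_extension_inner (ha : 0 < a) {U : Set (EuclideanSpace ℝ (Fin d))} (hU : IsOpen U)
    (hne : U.Nonempty) (hD : U ⊆ closure D)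
    (hext : ∀ ξ, ∃ g, IsExtension a D f ξ g ∧ ∀ z ∈ tube d a, g z ≠ 0)
    (ξ : EuclideanSpace ℝ (Fin d)) :
    ∃ l : EuclideanSpace ℂ (Fin d) → ℂ, DifferentiableOn ℂ l (tube d a) ∧
      ∀ x ∈ D, l (complexVec x) = (inner ℝ (f x) ξ : ℝ) := by
  obtain ⟨x₀, hx₀⟩ : D.Nonempty := closure_nonempty_iff.1 (hne.mono hD)
  set p := complexVec x₀ with hp
  have hpt : p ∈ tube d a := complexVec_mem_tube ha x₀
  have h2pi : (2 * Real.pi * Complex.I : ℂ) ≠ 0 := Complex.two_pi_I_ne_zero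
  have hlog : ∀ η : EuclideanSpace ℝ (Fin d), ∃ l : EuclideanSpace ℂ (Fin d) → ℂ,
      DifferentiableOn ℂ l (tube d a) ∧ l p = (inner ℝ (f x₀) η : ℝ) ∧
      IsExtension a D f η (fun z => Complex.exp (2 * Real.pi * Complex.I * l z)) := by
    intro η
    obtain ⟨g, hg, hg0⟩ := hext η
    obtain ⟨m, hm, hmg⟩ := exists_log_tube ha hg.1 hg0
    have hshift : ∀ z, 2 * Real.pi * Complex.I *
        ((m z - m p) * (2 * Real.pi * Complex.I)⁻¹ + (inner ℝ (f x₀) η : ℝ))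
        = m z + (-m p + (2 * Real.pi * inner ℝ (f x₀) η : ℝ) * Complex.I) := by
      intro z; field_simp; push_cast; ring
    have hone : Complex.exp (-m p + (2 * Real.pi * inner ℝ (f x₀) η : ℝ) * Complex.I) = 1 := by
      rw [Complex.exp_add, Complex.exp_neg, hmg p hpt, hp, hg.2 x₀ hx₀]
      exact inv_mul_cancel₀ (character_ne_zero _ _)
    refine ⟨fun z => (m z - m p) * (2 * Real.pi * Complex.I)⁻¹ + (inner ℝ (f x₀) η : ℝ),
      ((hm.sub_const _).mul_const _).add_const _, by simp, ?_, ?_⟩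
    · exact (((((hm.sub_const _).mul_const _).add_const _)).const_mul _).cexp
    · intro x hx
      beta_reduce
      rw [hshift, Complex.exp_add, hone, mul_one, hmg _ (complexVec_mem_tube ha x), hg.2 x hx]
  obtain ⟨l, hl, hlp, hle⟩ := hlog ξ
  refine ⟨l, hl, fun x hx => ?_⟩
  have hint : ∀ {η : EuclideanSpace ℝ (Fin d)} {k : EuclideanSpace ℂ (Fin d) → ℂ},
      IsExtension a D f η (fun z => Complex.exp (2 * Real.pi * Complex.I * k z)) →
      ∃ n : ℤ, k (complexVec x) = (inner ℝ (f x) η : ℝ) + n := by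
    intro η k hk
    have := hk.2 x hx
    rw [character, Complex.exp_eq_exp_iff_exists_int] at this
    obtain ⟨n, hn⟩ := this
    refine ⟨n, mul_left_cancel₀ h2pi ?_⟩
    rw [hn]; push_cast; ring
  have hdiv : ∀ N : ℕ, 0 < N → ∃ n : ℤ, l (complexVec x) = (inner ℝ (f x) ξ : ℝ) + N * n := by
    intro N hN
    have hN' : (N : ℝ) ≠ 0 := by positivity
    have hNC : (N : ℂ) ≠ 0 := by exact_mod_cast hN.ne'
    obtain ⟨k, hk, hkp, hke⟩ := hlog ((1 / (N : ℝ)) • ξ)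
    -- `N k - l` is integer valued and continuous on the connected tube, and vanishes at `p`
    have hNk : (N : ℂ) * k (complexVec x) = l (complexVec x) := by
      have hsame : ∀ z ∈ tube d a, Complex.exp (2 * Real.pi * Complex.I * k z) ^ N =
          Complex.exp (2 * Real.pi * Complex.I * l z) := by
        refine eqOn_tube (hke.1.pow N) hle.1 hU hne hD fun y hy => ?_
        have h1 := hke.2 y hy
        have h2 := hle.2 y hy
        beta_reduce at h1 h2 ⊢
        rw [h1, h2, ← character_nsmul, smul_smul, mul_one_div_cancel hN', one_smul]
      have hval : ∀ z ∈ tube d a, N * k z - l z ∈ (AddSubgroup.zmultiples (1 : ℂ) : Set ℂ) := by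
        intro z hz
        have := hsame z hz
        rw [← Complex.exp_nat_mul, Complex.exp_eq_exp_iff_exists_int] at this
        obtain ⟨n, hn⟩ := this
        refine ⟨n, mul_left_cancel₀ h2pi ?_⟩
        simp only [zsmul_eq_mul, mul_one]
        linear_combination -hn
      have hdisc : IsDiscrete (AddSubgroup.zmultiples (1 : ℂ) : Set ℂ) :=
        isDiscrete_iff_discreteTopology.2 (NormedSpace.discreteTopology_zmultiples (1 : ℂ))
      have hconst := (convex_tube (d := d) a).isPreconnected.constant_of_mapsTo hdisc
        ((continuousOn_const.mul hk.continuousOn).sub hl.continuousOn) hval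
        (complexVec_mem_tube ha x) hpt
      have hp0 : (N : ℂ) * k p - l p = 0 := by
        rw [hkp, hlp, inner_smul_right]; push_cast; field_simp; ring
      exact sub_eq_zero.1 (hconst.trans hp0)
    obtain ⟨n, hn⟩ := hint hke
    refine ⟨n, ?_⟩
    rw [← hNk, hn, inner_smul_right]
    push_cast
    field_simp
  obtain ⟨n, hn⟩ := hint hle
  obtain ⟨m, hm⟩ := hdiv (n.natAbs + 1) (by omega)
  have hnm : n = (n.natAbs + 1 : ℕ) * m := by
    have : (n : ℂ) = ((n.natAbs + 1 : ℕ) : ℂ) * m := by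
      rw [hn] at hm; exact add_left_cancel hm
    refine Int.cast_injective (α := ℂ) ?_
    rw [this, Int.cast_mul, Int.cast_natCast]
  have hn0 : n = 0 := Int.eq_zero_of_abs_lt_dvd ⟨m, hnm⟩ (by
    rw [Int.abs_eq_natAbs]; push_cast; omega)
  rw [hn, hn0]; simp

theorem exists_extension_of_pos_measure (ha : 0 < a) {U : Set (EuclideanSpace ℝ (Fin d))}
    (hU : IsOpen U) (hne : U.Nonempty) (hD : U ⊆ closure D)
    {E : Set (EuclideanSpace ℝ (Fin d))} (hE : MeasurableSet E) (hpos : 0 < volume E)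
    (hext : ∀ ξ ∈ E, ∃ g, IsExtension a D f ξ g) :
    ∃ F : EuclideanSpace ℂ (Fin d) → EuclideanSpace ℂ (Fin d),
      DifferentiableOn ℂ F (tube d a) ∧ ∀ x ∈ D, F (complexVec x) = complexVec (f x) := by
  choose l hl hlx using fun i : Fin d => exists_extension_inner ha hU hne hD
    (forall_exists_isExtension ha hU hne hD hE hpos hext) (EuclideanSpace.single i 1)
  refine ⟨fun z => WithLp.toLp 2 fun i => l i z, ?_, fun x hx => ?_⟩
  · rw [differentiableOn_euclidean]
    exact hl
  · ext i
    simp [hlx i x hx, EuclideanSpace.inner_single_right]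

end Characters

/-! ### Fourier inversion and positivity of the Fourier transform -/

section Fourier

variable {d : ℕ}

lemma continuous_character (ξ : EuclideanSpace ℝ (Fin d)) : Continuous (character ξ) := by
  unfold character; fun_prop

lemma continuous_character_left (x : EuclideanSpace ℝ (Fin d)) :
    Continuous fun ξ => character ξ x := by
  unfold character; fun_prop

@[simp] lemma norm_character (ξ x : EuclideanSpace ℝ (Fin d)) : ‖character ξ x‖ = 1 :=
  Complex.norm_exp_ofReal_mul_I _

lemma fourierInv_eq_character (w : EuclideanSpace ℝ (Fin d) → ℂ) (x : EuclideanSpace ℝ (Fin d)) :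
    𝓕⁻ w x = ∫ ξ, character ξ x * w ξ := by
  rw [Real.fourierInv_eq']
  simp only [character, real_inner_comm, smul_eq_mul]

lemma integral_fourierInv_mul {f g : EuclideanSpace ℝ (Fin d) → ℂ} (hf : Integrable f)
    (hg : Integrable g) : ∫ x, 𝓕⁻ f x * g x = ∫ x, f x * 𝓕⁻ g x := by
  have h := VectorFourier.integral_fourierIntegral_smul_eq_flip (μ := volume) (ν := volume)
    (L := -innerₗ (EuclideanSpace ℝ (Fin d))) Real.continuous_fourierChar
    continuous_inner.neg hf hg
  have e : ∀ (L : EuclideanSpace ℝ (Fin d) →ₗ[ℝ] EuclideanSpace ℝ (Fin d) →ₗ[ℝ] ℝ),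
      (∀ x y, L x y = - inner ℝ x y) → ∀ k : EuclideanSpace ℝ (Fin d) → ℂ,
      VectorFourier.fourierIntegral Real.fourierChar volume L k = 𝓕⁻ k := by
    intro L hL k
    ext x
    rw [Real.fourierInv_eq]
    simp [VectorFourier.fourierIntegral, hL]
  rw [e _ (by simp), e _ (by simp [real_inner_comm])] at h
  simpa using h

lemma integral_fourier_mul {f g : EuclideanSpace ℝ (Fin d) → ℂ} (hf : Integrable f)
    (hg : Integrable g) : ∫ x, 𝓕 f x * g x = ∫ x, f x * 𝓕 g x := by
  have h := VectorFourier.integral_fourierIntegral_smul_eq_flip (μ := volume) (ν := volume)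
    (L := innerₗ (EuclideanSpace ℝ (Fin d))) Real.continuous_fourierChar
    continuous_inner hf hg
  simpa [Real.fourier_eq, VectorFourier.fourierIntegral, real_inner_comm] using h

lemma fourierInv_conj (f : EuclideanSpace ℝ (Fin d) → ℂ) (ξ : EuclideanSpace ℝ (Fin d)) :
    𝓕⁻ (fun x => conj (f x)) ξ = conj (𝓕 f ξ) := by
  rw [Real.fourierInv_eq', Real.fourier_eq', ← integral_conj]
  congr 1
  ext x
  rw [smul_eq_mul, smul_eq_mul, map_mul, ← Complex.exp_conj]
  congr 2
  simp only [map_mul, Complex.conj_ofReal, Complex.conj_I]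
  push_cast; ring

variable {u : EuclideanSpace ℝ (Fin d) → ℂ} (hu_L2 : MemLp u 2 volume)

/-- Fourier inversion for a continuous square integrable function whose Fourier transform is
integrable. -/
theorem eq_integral_character (hu_cont : Continuous u)
    (hw : MemLp (fourierL2 u hu_L2) 1 volume) (x : EuclideanSpace ℝ (Fin d)) :
    u x = ∫ ξ, character ξ x * fourierL2 u hu_L2 ξ := by
  have hwi : Integrable (fourierL2 u hu_L2) := memLp_one_iff_integrable.1 hw
  have hcont : Continuous (𝓕⁻ (fourierL2 u hu_L2 : EuclideanSpace ℝ (Fin d) → ℂ)) := by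
    have : 𝓕⁻ (fourierL2 u hu_L2 : EuclideanSpace ℝ (Fin d) → ℂ)
        = fun x => ∫ ξ, character ξ x * fourierL2 u hu_L2 ξ :=
      funext fun x => fourierInv_eq_character _ x
    rw [this]
    refine continuous_of_dominated (bound := fun ξ => ‖fourierL2 u hu_L2 ξ‖) ?_ ?_ hwi.norm ?_
    · exact fun x => ((continuous_character_left x).aestronglyMeasurable).mul
        hwi.aestronglyMeasurable
    · exact fun x => Filter.Eventually.of_forall fun ξ => by simp
    · exact Filter.Eventually.of_forall fun ξ => (continuous_character ξ).mul continuous_const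
  have hae : ∀ᵐ x, u x = 𝓕⁻ (fourierL2 u hu_L2 : EuclideanSpace ℝ (Fin d) → ℂ) x := by
    refine ae_eq_of_integral_contDiff_smul_eq (hu_cont.locallyIntegrable)
      hcont.locallyIntegrable fun g hg hgs => ?_
    set G : SchwartzMap (EuclideanSpace ℝ (Fin d)) ℂ :=
      HasCompactSupport.toSchwartzMap (f := fun x => (g x : ℂ))
        (hgs.comp_left (g := Complex.ofReal) (by simp))
        (Complex.ofRealCLM.contDiff.comp hg) with hG
    have hGv : ∀ x, G x = g x := fun x => rfl
    have h1 := DFunLike.congr_fun (Lp.fourierInv_toTemperedDistribution_eq (fourierL2 u hu_L2)) G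
    have h2 : 𝓕⁻ (fourierL2 u hu_L2) = hu_L2.toLp u := FourierTransform.fourierInv_fourier_eq _
    rw [h2, TemperedDistribution.fourierInv_apply, Lp.toTemperedDistribution_apply,
      Lp.toTemperedDistribution_apply] at h1
    have h3 : ∫ x, G x • (hu_L2.toLp u) x = ∫ x, g x • u x := by
      refine integral_congr_ae ?_
      filter_upwards [hu_L2.coeFn_toLp] with x hx
      rw [hx, hGv]; simp
    rw [← h3, ← h1]
    have h4 := integral_fourierInv_mul G.integrable hwi
    simp only [SchwartzMap.fourierInv_coe, smul_eq_mul]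
    rw [h4]
    simp [hGv]
  have := (Continuous.ae_eq_iff_eq volume hu_cont hcont).1 hae
  rw [congrFun this x, fourierInv_eq_character]

/-- Testing positive definiteness against the weight `ψ`: the integral is the square of the norm of
`∫ ψ(y) k(·,y) dy` in the reproducing kernel Hilbert space. -/
lemma integral_mul_normSq_fourier_nonneg (hu_cont : Continuous u)
    (hu_pd : IsPositiveDefiniteKernel fun x y => u (x - y))
    (hw : MemLp (fourierL2 u hu_L2) 1 volume)
    (ψ : SchwartzMap (EuclideanSpace ℝ (Fin d)) ℂ) :
    0 ≤ ∫ ξ, fourierL2 u hu_L2 ξ * ((‖𝓕 ψ ξ‖ ^ 2 : ℝ) : ℂ) := by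
  have hwi : Integrable (fourierL2 u hu_L2) := memLp_one_iff_integrable.1 hw
  choose k hk hkr using fun y => hu_pd.reproducing y
  have hinner : ∀ x y, inner ℂ (k x) (k y) = u (x - y) := fun x y => by rw [hkr, hk]
  have hknorm : ∀ x, ‖k x‖ ^ 2 = (u 0).re := fun x => by
    have h := hinner x x
    rw [sub_self, inner_self_eq_norm_sq_to_K] at h
    rw [← h]; norm_cast
  have hkc : Continuous k := by
    refine continuous_iff_continuousAt.2 fun y => tendsto_iff_norm_sub_tendsto_zero.2 ?_
    have h1 : ∀ x, ‖k x - k y‖ = √(2 * (u 0).re - 2 * (u (x - y)).re) := by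
      intro x
      rw [← Real.sqrt_sq (norm_nonneg (k x - k y)), @norm_sub_sq ℂ, hknorm, hknorm, hinner]
      congr 1
      simp only [RCLike.re_to_complex]
      ring
    simp only [h1]
    have h2 : Continuous fun x => √(2 * (u 0).re - 2 * (u (x - y)).re) := by fun_prop
    simpa using h2.tendsto y
  have hkb : ∀ x, ‖k x‖ = √(u 0).re := fun x => by
    rw [← hknorm x, Real.sqrt_sq (norm_nonneg _)]
  have hki : Integrable fun y => ψ y • k y := by
    refine (ψ.integrable.norm.mul_const √(u 0).re).mono'
      (ψ.continuous.smul hkc).aestronglyMeasurable (Filter.Eventually.of_forall fun y => ?_)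
    rw [norm_smul, hkb]
  set Ψ := ∫ y, ψ y • k y with hΨ
  have hwψ : Integrable fun ξ => fourierL2 u hu_L2 ξ * 𝓕 ψ ξ := by
    have hC := fun ξ => (𝓕 ψ).toBoundedContinuousFunction.norm_coe_le_norm ξ
    exact hwi.mul_bdd (𝓕 ψ).continuous.aestronglyMeasurable
      (Filter.Eventually.of_forall fun ξ => hC ξ)
  have h1 : ∀ x, inner ℂ (k x) Ψ = 𝓕⁻ (fun ξ => fourierL2 u hu_L2 ξ * 𝓕 ψ ξ) x := by
    intro x
    have hwx : Integrable fun ξ => character ξ x * fourierL2 u hu_L2 ξ :=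
      hwi.bdd_mul (c := 1) (continuous_character_left x).aestronglyMeasurable
        (Filter.Eventually.of_forall fun ξ => by simp)
    have h2 : ∀ y, u (x - y) = 𝓕 (fun ξ => character ξ x * fourierL2 u hu_L2 ξ) y := by
      intro y
      rw [eq_integral_character hu_L2 hu_cont hw, Real.fourier_eq']
      congr 1
      ext ξ
      rw [smul_eq_mul, ← mul_assoc, character, character, ← Complex.exp_add]
      congr 2
      rw [inner_sub_left, real_inner_comm ξ y]
      push_cast; ring
    rw [hΨ, ← integral_inner hki (k x)]
    simp only [inner_smul_right, hinner, h2]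
    simp_rw [mul_comm (ψ _)]
    rw [integral_fourier_mul hwx ψ.integrable, fourierInv_eq_character]
    simp only [SchwartzMap.fourier_coe, mul_assoc]
  have h2 : inner ℂ Ψ Ψ = ∫ ξ, fourierL2 u hu_L2 ξ * ((‖𝓕 ψ ξ‖ ^ 2 : ℝ) : ℂ) := by
    have hψc : Integrable fun x => conj (ψ x) :=
      (Complex.conjLIE.toContinuousLinearEquiv.toContinuousLinearMap).integrable_comp ψ.integrable
    have h3 : conj (inner ℂ Ψ Ψ) = ∫ x, conj (ψ x) *
        𝓕⁻ (fun ξ => fourierL2 u hu_L2 ξ * 𝓕 ψ ξ) x := by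
      nth_rw 2 [hΨ]
      rw [← integral_inner hki Ψ, ← integral_conj]
      congr 1
      ext x
      rw [inner_smul_right, map_mul, inner_conj_symm, h1]
    rw [inner_conj_symm] at h3
    rw [h3, ← integral_fourierInv_mul hψc hwψ]
    congr 1
    ext ξ
    rw [fourierInv_conj, ← SchwartzMap.fourier_coe, mul_left_comm, mul_comm (conj _),
      Complex.mul_conj, Complex.normSq_eq_norm_sq]
  rw [← h2, inner_self_eq_norm_sq_to_K]
  simp

/-- The Fourier transform of a positive definite function is nonnegative. -/
theorem fourierL2_nonneg (hu_cont : Continuous u)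
    (hu_pd : IsPositiveDefiniteKernel fun x y => u (x - y))
    (hw : MemLp (fourierL2 u hu_L2) 1 volume) (hw' : MemLp (fourierL2 u hu_L2) ⊤ volume) :
    ∀ᵐ ξ, 0 ≤ fourierL2 u hu_L2 ξ := by
  have hwi : Integrable (fourierL2 u hu_L2) := memLp_one_iff_integrable.1 hw
  set M : Lp (α := EuclideanSpace ℝ (Fin d)) ℂ 2 →L[ℂ] Lp (α := EuclideanSpace ℝ (Fin d)) ℂ 2 :=
    (ContinuousLinearMap.mul ℂ ℂ).holderL volume ⊤ 2 2 (hw'.toLp _) with hM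
  have hMv : ∀ φ : Lp (α := EuclideanSpace ℝ (Fin d)) ℂ 2,
      M φ =ᵐ[volume] fun ξ => fourierL2 u hu_L2 ξ * φ ξ := by
    intro φ
    have h1 := (ContinuousLinearMap.mul ℂ ℂ).coeFn_holder (r := 2) (hw'.toLp _) φ
    filter_upwards [h1, hw'.coeFn_toLp] with ξ h1 h2
    rw [h2] at h1
    exact h1
  have hS : ∀ φ : SchwartzMap (EuclideanSpace ℝ (Fin d)) ℂ,
      0 ≤ inner ℂ (φ.toLp 2 volume) (M (φ.toLp 2 volume)) := by
    intro φ
    have h1 := integral_mul_normSq_fourier_nonneg hu_L2 hu_cont hu_pd hw (𝓕⁻ φ)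
    rw [FourierTransform.fourier_fourierInv_eq] at h1
    refine h1.trans_eq ?_
    rw [L2.inner_def]
    refine integral_congr_ae ?_
    filter_upwards [hMv (φ.toLp 2 volume), φ.coeFn_toLp 2 volume] with ξ h1 h2
    rw [h1, h2]
    simp only [RCLike.inner_apply]
    rw [mul_assoc, Complex.mul_conj, Complex.normSq_eq_norm_sq]
  have hcl : IsClosed {φ : Lp (α := EuclideanSpace ℝ (Fin d)) ℂ 2 | 0 ≤ inner ℂ φ (M φ)} :=
    isClosed_le continuous_const (continuous_id.inner M.continuous)
  have hdense : DenseRange fun φ : SchwartzMap (EuclideanSpace ℝ (Fin d)) ℂ => φ.toLp 2 volume :=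
    SchwartzMap.denseRange_toLpCLM (F := ℂ) (p := 2) (μ := volume) ENNReal.ofNat_ne_top
  have hpos : ∀ φ : Lp (α := EuclideanSpace ℝ (Fin d)) ℂ 2, 0 ≤ inner ℂ φ (M φ) :=
    fun φ => hdense.induction_on φ hcl hS
  have hset : ∀ s, MeasurableSet s → volume s < ⊤ → 0 ≤ ∫ ξ in s, fourierL2 u hu_L2 ξ := by
    intro s hs hsf
    refine (hpos (indicatorConstLp 2 hs hsf.ne 1)).trans_eq ?_
    rw [L2.inner_indicatorConstLp_one]
    refine setIntegral_congr_ae hs ?_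
    filter_upwards [hMv (indicatorConstLp 2 hs hsf.ne 1),
      indicatorConstLp_coeFn (p := 2) (hs := hs) (hμs := hsf.ne) (c := (1 : ℂ))] with ξ h1 h2 hξ
    rw [h1, h2, Set.indicator_of_mem hξ, mul_one]
  have hre : 0 ≤ᵐ[volume] fun ξ => (fourierL2 u hu_L2 ξ).re :=
    ae_nonneg_of_forall_setIntegral_nonneg hwi.re fun s hs hsf => by
      have := (Complex.le_def.1 (hset s hs hsf)).1
      rw [← RCLike.re_to_complex, ← RCLike.re_to_complex, ← integral_re hwi.integrableOn] at this
      exact this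
  have him : ∀ s, MeasurableSet s → volume s < ⊤ →
      ∫ ξ in s, (fourierL2 u hu_L2 ξ).im = 0 := fun s hs hsf => by
    have := (Complex.le_def.1 (hset s hs hsf)).2
    rw [← RCLike.im_to_complex, ← RCLike.im_to_complex, ← integral_im hwi.integrableOn] at this
    exact this.symm
  have him0 : (fun ξ => (fourierL2 u hu_L2 ξ).im) =ᵐ[volume] 0 :=
    hwi.im.ae_eq_zero_of_forall_setIntegral_eq_zero him
  filter_upwards [hre, him0] with ξ h1 h2
  exact Complex.le_def.2 ⟨h1, h2.symm⟩

end Fourier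

/-! ### The spectral measure -/

section SpectralMeasure

variable {d : ℕ} {u : EuclideanSpace ℝ (Fin d) → ℂ}

lemma integrable_inv_one_add_rpow {r : ℝ} (hr : (d : ℝ) < r) (hr1 : 1 ≤ r) :
    Integrable fun ξ : EuclideanSpace ℝ (Fin d) => (1 + ‖ξ‖ ^ r)⁻¹ := by
  have h := integrable_one_add_norm (μ := (volume : Measure (EuclideanSpace ℝ (Fin d)))) (r := r)
    (by simpa using hr)
  refine (h.const_mul (2 ^ (r - 1))).mono' ?_ (Filter.Eventually.of_forall fun ξ => ?_)
  · have : Continuous fun ξ : EuclideanSpace ℝ (Fin d) => ‖ξ‖ ^ r :=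
      continuous_norm.rpow_const fun _ => Or.inr (by linarith)
    exact ((continuous_const.add this).inv₀ fun ξ =>
      (by positivity : 0 < 1 + ‖ξ‖ ^ r).ne').aestronglyMeasurable
  · have h1 : (1 + ‖ξ‖) ^ r ≤ 2 ^ (r - 1) * (1 ^ r + ‖ξ‖ ^ r) := by
      exact_mod_cast NNReal.rpow_add_le_mul_rpow_add_rpow 1 ‖ξ‖₊ hr1
    rw [Real.one_rpow] at h1
    have hp : 0 < (1 + ‖ξ‖) ^ r := by positivity
    rw [Real.norm_of_nonneg (by positivity), Real.rpow_neg (by positivity), ← div_eq_mul_inv,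
      le_div_iff₀ hp, inv_mul_le_iff₀ (by positivity), mul_comm]
    exact h1

/-- Bochner's representation `u(x) = ∫ e^{2πi x·ξ} dμ(ξ)`, with `μ` of density `û`, and the
exponential moment that the decay condition gives. -/
theorem exists_spectralMeasure (hu_cont : Continuous u) (hu_L2 : MemLp u 2 volume) (hu_ne : u ≠ 0)
    (hu_pd : IsPositiveDefiniteKernel fun x y => u (x - y))
    (hw : MemLp (fourierL2 u hu_L2) 1 volume) (hw' : MemLp (fourierL2 u hu_L2) ⊤ volume)
    {n : ℕ} {a : ℝ} (hDC : DecayCondition n a (fourierL2 u hu_L2)) :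
    ∃ μ : Measure (EuclideanSpace ℝ (Fin d)), IsFiniteMeasure μ ∧ μ ≪ volume ∧ μ ≠ 0 ∧
      Integrable (fun ξ => Real.exp (4 * Real.pi * a * ‖ξ‖)) μ ∧
      ∀ x, u x = ∫ ξ, character ξ x ∂μ := by
  have hwi : Integrable (fourierL2 u hu_L2) := memLp_one_iff_integrable.1 hw
  set w : EuclideanSpace ℝ (Fin d) → ℂ := ⇑(fourierL2 u hu_L2) with hwdef
  have hnn : ∀ᵐ ξ, 0 ≤ w ξ := fourierL2_nonneg hu_L2 hu_cont hu_pd hw hw'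
  have hm : AEMeasurable (fun ξ => (w ξ).re.toNNReal) :=
    hwi.re.aestronglyMeasurable.aemeasurable.real_toNNReal
  set μ : Measure (EuclideanSpace ℝ (Fin d)) :=
    volume.withDensity fun ξ => ((w ξ).re.toNNReal : ENNReal) with hμ
  have hrep : ∀ x, u x = ∫ ξ, character ξ x ∂μ := by
    intro x
    rw [hμ, integral_withDensity_eq_integral_smul₀ hm, eq_integral_character hu_L2 hu_cont hw]
    refine integral_congr_ae ?_
    filter_upwards [hnn] with ξ hξ
    obtain ⟨h1, h2⟩ := Complex.le_def.1 hξ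
    have h3 : w ξ = ((w ξ).re : ℂ) := Complex.ext (by simp) (by simpa using h2.symm)
    rw [NNReal.smul_def, Real.coe_toNNReal _ h1, Complex.real_smul, ← h3, mul_comm]
  refine ⟨μ, ?_, withDensity_absolutelyContinuous _ _, ?_, ?_, hrep⟩
  · refine isFiniteMeasure_withDensity ?_
    exact hwi.re.lintegral_lt_top.ne
  · intro h0
    apply hu_ne
    ext x
    rw [hrep, h0]; simp
  · rw [hμ, integrable_withDensity_iff_integrable_smul₀ hm]
    obtain ⟨C, hC, hle⟩ := hDC 1 one_pos
    have hr : (d : ℝ) < 2 * (n : ℝ) + d + 1 := by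
      have : (0 : ℝ) ≤ n := n.cast_nonneg
      linarith
    have hr1 : 1 ≤ 2 * (n : ℝ) + d + 1 := by
      have : (0 : ℝ) ≤ d := d.cast_nonneg
      have : (0 : ℝ) ≤ n := n.cast_nonneg
      linarith
    refine ((integrable_inv_one_add_rpow hr hr1).const_mul C).mono' ?_ ?_
    · exact (hm.coe_nnreal_real.smul (by fun_prop)).aestronglyMeasurable
    · filter_upwards [hle] with ξ hξ
      rw [NNReal.smul_def, smul_eq_mul, norm_mul, Real.norm_of_nonneg (Real.exp_pos _).le,
        Real.norm_of_nonneg (NNReal.coe_nonneg _), Real.coe_toNNReal']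
      have h1 : max (w ξ).re 0 ≤ ‖w ξ‖ := max_le (Complex.re_le_norm _) (norm_nonneg _)
      refine (mul_le_mul_of_nonneg_right (h1.trans hξ) (Real.exp_pos _).le).trans_eq ?_
      rw [mul_assoc, ← Real.exp_add]
      simp

end SpectralMeasure

/-! ### The bounded operator on the spectral side -/

section Operator

/-- A bounded correspondence between two families in a Hilbert space, extended by zero on the
orthogonal complement of the first family. -/
lemma exists_continuousLinearMap_of_norm_le {ι H : Type*} [NormedAddCommGroup H]
    [InnerProductSpace ℂ H] [CompleteSpace H] (v w : ι → H) (C : ℝ)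
    (h : ∀ c : ι →₀ ℂ, ‖Finsupp.linearCombination ℂ w c‖ ≤
      C * ‖Finsupp.linearCombination ℂ v c‖) :
    ∃ S : H →L[ℂ] H, ∀ i, S (v i) = w i := by
  set K := (LinearMap.range (Finsupp.linearCombination ℂ v)).topologicalClosure with hK
  have hmem : ∀ c, Finsupp.linearCombination ℂ v c ∈ K := fun c =>
    Submodule.le_topologicalClosure _ ⟨c, rfl⟩
  set e : (ι →₀ ℂ) →ₗ[ℂ] K := (Finsupp.linearCombination ℂ v).codRestrict K hmem with he
  have hdense : DenseRange e := by
    rw [DenseRange, Subtype.dense_iff]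
    intro x hx
    have hrange : Subtype.val '' Set.range e = Set.range (Finsupp.linearCombination ℂ v) := by
      rw [← Set.range_comp]; rfl
    exact hrange.symm ▸ hx
  have hKc : CompleteSpace K := (Submodule.isClosed_topologicalClosure _).completeSpace_coe
  refine ⟨((Finsupp.linearCombination ℂ w).extendOfNorm e) ∘L K.orthogonalProjectionOnto,
    fun i => ?_⟩
  have h1 : v i = (e (Finsupp.single i 1) : H) := by simp [he]
  have h2 : K.orthogonalProjectionOnto (v i) = e (Finsupp.single i 1) := by
    rw [h1]; exact Submodule.orthogonalProjectionOnto_mem_subspace_eq_self _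
  rw [ContinuousLinearMap.comp_apply, h2, LinearMap.extendOfNorm_eq hdense ⟨C, h⟩]
  simp

/-- Families with complex conjugate Gram matrices have linear combinations of the same norm. -/
lemma norm_sum_eq_of_inner_eq {ι H H' : Type*} [NormedAddCommGroup H] [InnerProductSpace ℂ H]
    [NormedAddCommGroup H'] [InnerProductSpace ℂ H'] (v : ι → H) (w : ι → H')
    (h : ∀ i j, inner ℂ (v i) (v j) = inner ℂ (w j) (w i)) (s : Finset ι) (c : ι → ℂ) :
    ‖∑ i ∈ s, c i • v i‖ = ‖∑ i ∈ s, conj (c i) • w i‖ := by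
  have : (inner ℂ (∑ i ∈ s, c i • v i) (∑ i ∈ s, c i • v i) : ℂ) =
      inner ℂ (∑ i ∈ s, conj (c i) • w i) (∑ i ∈ s, conj (c i) • w i) := by
    simp only [sum_inner, inner_sum, inner_smul_left, inner_smul_right, h, Complex.conj_conj,
      Finset.mul_sum]
    rw [Finset.sum_comm]
    refine Finset.sum_congr rfl fun i _ => Finset.sum_congr rfl fun j _ => ?_
    ring
  rw [norm_eq_sqrt_re_inner (𝕜 := ℂ),
    norm_eq_sqrt_re_inner (𝕜 := ℂ) (∑ i ∈ s, conj (c i) • w i), this]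

variable {d : ℕ} {u : EuclideanSpace ℝ (Fin d) → ℂ}

/-- Boundedness of the composition operator, read off on its adjoint, which sends `k(·,q)` to
`k(·,f(q))`. -/
lemma norm_sum_kernel_le (hu_pd : IsPositiveDefiniteKernel fun x y => u (x - y))
    {U : Set (EuclideanSpace ℝ (Fin d))} {f : U → EuclideanSpace ℝ (Fin d)}
    (hdom : (compositionOperator hu_pd.Space (hu_pd.restrict U).Space f).domain = ⊤)
    (hbdd : IsBoundedOperator (compositionOperator hu_pd.Space (hu_pd.restrict U).Space f))
    {k : EuclideanSpace ℝ (Fin d) → hu_pd.Space}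
    (hk : ∀ y (h : hu_pd.Space), inner ℂ (k y) h = h y)
    {kU : U → (hu_pd.restrict U).Space}
    (hkU : ∀ y (h : (hu_pd.restrict U).Space), inner ℂ (kU y) h = h y) :
    ∃ C : ℝ, ∀ (s : Finset U) (c : U → ℂ),
      ‖∑ q ∈ s, c q • k (f q)‖ ≤ C * ‖∑ q ∈ s, c q • kU q‖ := by
  obtain ⟨C, hC⟩ := hbdd
  refine ⟨|C|, fun s c => ?_⟩
  set g := ∑ q ∈ s, c q • k (f q) with hg
  set g' := ∑ q ∈ s, c q • kU q with hg'
  have hgd : g ∈ (compositionOperator hu_pd.Space (hu_pd.restrict U).Space f).domain := by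
    rw [hdom]; trivial
  set Tg := compositionOperator hu_pd.Space (hu_pd.restrict U).Space f ⟨g, hgd⟩ with hTg
  have h1 : (inner ℂ g g : ℂ) = inner ℂ g' Tg := by
    rw [hg']
    nth_rw 1 [hg]
    rw [sum_inner, sum_inner]
    refine Finset.sum_congr rfl fun q _ => ?_
    rw [inner_smul_left, inner_smul_left, hk, hkU, hTg, compositionOperator_apply]
  have h2 : ‖g‖ * ‖g‖ ≤ |C| * ‖g'‖ * ‖g‖ := by
    have h3 : ‖(inner ℂ g g : ℂ)‖ = ‖g‖ * ‖g‖ := by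
      rw [inner_self_eq_norm_sq_to_K]; simp [sq]
    rw [← h3, h1]
    refine (norm_inner_le_norm _ _).trans ?_
    have := mul_le_mul_of_nonneg_left ((hC ⟨g, hgd⟩).trans
      (mul_le_mul_of_nonneg_right (le_abs_self C) (norm_nonneg _))) (norm_nonneg g')
    calc _ ≤ _ := this
      _ = _ := by ring
  rcases (norm_nonneg g).eq_or_lt with h0 | h0
  · rw [← h0]
    positivity
  · exact le_of_mul_le_mul_right h2 h0

/-- The function `ξ ↦ e^{2πi x·ξ}` as an element of `L²(μ)`. -/
noncomputable def charL2 (μ : Measure (EuclideanSpace ℝ (Fin d))) [IsFiniteMeasure μ]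
    (x : EuclideanSpace ℝ (Fin d)) : Lp ℂ 2 μ :=
  (MemLp.of_bound (p := 2) (μ := μ) (f := fun ξ => character ξ x)
    (continuous_character_left x).aestronglyMeasurable 1 (by simp)).toLp _

lemma coeFn_charL2 (μ : Measure (EuclideanSpace ℝ (Fin d))) [IsFiniteMeasure μ]
    (x : EuclideanSpace ℝ (Fin d)) : charL2 μ x =ᵐ[μ] fun ξ => character ξ x :=
  MemLp.coeFn_toLp _

lemma inner_charL2 (μ : Measure (EuclideanSpace ℝ (Fin d))) [IsFiniteMeasure μ]
    (x y : EuclideanSpace ℝ (Fin d)) :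
    inner ℂ (charL2 μ x) (charL2 μ y) = ∫ ξ, character ξ (y - x) ∂μ := by
  rw [L2.inner_def]
  refine integral_congr_ae ?_
  filter_upwards [coeFn_charL2 μ x, coeFn_charL2 μ y] with ξ h1 h2
  rw [h1, h2]
  simp only [RCLike.inner_apply, character, ← Complex.exp_conj, ← Complex.exp_add]
  congr 1
  simp only [map_mul, Complex.conj_ofReal, Complex.conj_I, inner_sub_left]
  push_cast; ring

/-- A bounded composition operator gives a bounded operator on `L²(μ)` that maps `e^{2πi q·ξ}` to
`e^{2πi f(q)·ξ}` for every `q ∈ U`. -/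
theorem exists_operator_charL2 (hu_pd : IsPositiveDefiniteKernel fun x y => u (x - y))
    {U : Set (EuclideanSpace ℝ (Fin d))} {f : U → EuclideanSpace ℝ (Fin d)}
    (hdom : (compositionOperator hu_pd.Space (hu_pd.restrict U).Space f).domain = ⊤)
    (hbdd : IsBoundedOperator (compositionOperator hu_pd.Space (hu_pd.restrict U).Space f))
    (μ : Measure (EuclideanSpace ℝ (Fin d))) [IsFiniteMeasure μ]
    (hrep : ∀ x, u x = ∫ ξ, character ξ x ∂μ) :
    ∃ S : Lp ℂ 2 μ →L[ℂ] Lp ℂ 2 μ, ∀ q : U, S (charL2 μ q) = charL2 μ (f q) := by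
  choose k hk hkr using fun y => hu_pd.reproducing y
  choose kU hkU hkUr using fun y => (hu_pd.restrict U).reproducing y
  obtain ⟨C, hC⟩ := norm_sum_kernel_le hu_pd hdom hbdd hkr hkUr
  refine exists_continuousLinearMap_of_norm_le (fun q : U => charL2 μ q)
    (fun q : U => charL2 μ (f q)) C fun c => ?_
  simp only [Finsupp.linearCombination_apply, Finsupp.sum]
  rw [norm_sum_eq_of_inner_eq (fun q : U => charL2 μ q) kU
      (fun i j => by rw [inner_charL2, hkUr, hkU, hrep]),
    norm_sum_eq_of_inner_eq (fun q : U => charL2 μ (f q)) (fun q => k (f q))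
      (fun i j => by rw [inner_charL2, hkr, hk, hrep])]
  exact hC _ _

end Operator

/-! ### Series in `L²` that converge almost everywhere -/

section AlmostEverywhere

variable {α : Type*} [MeasurableSpace α] {μ : Measure α}

lemma ae_summable_of_summable_integral {f : ℕ → α → ℝ} (hf : ∀ n, Integrable (f n) μ)
    (hnn : ∀ n ξ, 0 ≤ f n ξ) (hs : Summable fun n => ∫ ξ, f n ξ ∂μ) :
    ∀ᵐ ξ ∂μ, Summable fun n => f n ξ := by
  have hm : ∀ n, AEMeasurable (fun ξ => ENNReal.ofReal (f n ξ)) μ := fun n =>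
    (hf n).aestronglyMeasurable.aemeasurable.ennreal_ofReal
  have h1 : ∫⁻ ξ, ∑' n, ENNReal.ofReal (f n ξ) ∂μ ≠ ⊤ := by
    rw [lintegral_tsum hm]
    have h2 : ∀ n, ∫⁻ ξ, ENNReal.ofReal (f n ξ) ∂μ = ENNReal.ofReal (∫ ξ, f n ξ ∂μ) := fun n =>
      (ofReal_integral_eq_lintegral_ofReal (hf n) (Filter.Eventually.of_forall (hnn n))).symm
    simp only [h2]
    exact hs.tsum_ofReal_ne_top
  filter_upwards [ae_lt_top' (AEMeasurable.tsum hm) h1] with ξ hξ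
  have := ENNReal.summable_toReal hξ.ne
  simpa [ENNReal.toReal_ofReal (hnn _ ξ)] using this

lemma ae_hasSum_of_summable_norm {f : ℕ → Lp ℂ 2 μ} (hf : Summable fun n => ‖f n‖) :
    ∀ᵐ ξ ∂μ, HasSum (fun n => f n ξ) ((∑' n, f n : Lp ℂ 2 μ) ξ) := by
  refine Lp.hasSum_coeFn_tsum ?_
  simpa [← ofReal_norm] using hf.tsum_ofReal_ne_top

lemma integral_norm_sq_eq_norm_sq (f : Lp ℂ 2 μ) : ∫ ξ, ‖f ξ‖ ^ 2 ∂μ = ‖f‖ ^ 2 := by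
  have h := L2.inner_def (𝕜 := ℂ) f f
  rw [inner_self_eq_norm_sq_to_K] at h
  have h2 : ∫ ξ, (inner ℂ (f ξ) (f ξ) : ℂ) ∂μ = ((∫ ξ, ‖f ξ‖ ^ 2 ∂μ : ℝ) : ℂ) := by
    rw [← integral_complex_ofReal]
    refine integral_congr_ae (Filter.Eventually.of_forall fun ξ => ?_)
    simp [inner_self_eq_norm_sq_to_K]
  rw [h2] at h
  exact Complex.ofReal_injective (by rw [← h]; simp)

lemma integrable_norm_sq (f : Lp ℂ 2 μ) : Integrable (fun ξ => ‖f ξ‖ ^ 2) μ :=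
  (memLp_two_iff_integrable_sq_norm (Lp.aestronglyMeasurable f)).1 (Lp.memLp f)

end AlmostEverywhere

/-! ### Homogeneous polynomials on `ℂ^d` -/

section Homogeneous

variable {d : ℕ}

/-- The coefficients of a tensor product of vectors have Euclidean norm the product of the norms; this
is what makes the expansions below converge on Euclidean balls of the full radius `a`. -/
lemma sum_prod_norm_sq {n : ℕ} (v : Fin n → EuclideanSpace ℂ (Fin d)) :
    ∑ i : Fin n → Fin d, ∏ k, ‖v k (i k)‖ ^ 2 = ∏ k, ‖v k‖ ^ 2 := by
  simp_rw [EuclideanSpace.norm_sq_eq]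
  rw [Finset.prod_univ_sum]
  simp

/-- The `n`-linear form on `ℂ^d` with coefficients `c i`, `i : Fin n → Fin d`. -/
noncomputable def multilinearOfCoeff {n : ℕ} (c : (Fin n → Fin d) → ℂ) :
    ContinuousMultilinearMap ℂ (fun _ : Fin n => EuclideanSpace ℂ (Fin d)) ℂ :=
  ∑ i, c i • (ContinuousMultilinearMap.mkPiAlgebra ℂ (Fin n) ℂ).compContinuousLinearMap
    fun k => (EuclideanSpace.proj (i k) : EuclideanSpace ℂ (Fin d) →L[ℂ] ℂ)

lemma multilinearOfCoeff_apply {n : ℕ} (c : (Fin n → Fin d) → ℂ)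
    (v : Fin n → EuclideanSpace ℂ (Fin d)) :
    multilinearOfCoeff c v = ∑ i, c i * ∏ k, v k (i k) := by
  simp [multilinearOfCoeff]

lemma norm_multilinearOfCoeff_sq_le {n : ℕ} (c : (Fin n → Fin d) → ℂ) :
    ‖multilinearOfCoeff c‖ ^ 2 ≤ ∑ i, ‖c i‖ ^ 2 := by
  have h : ‖multilinearOfCoeff c‖ ≤ √(∑ i, ‖c i‖ ^ 2) := by
    refine ContinuousMultilinearMap.opNorm_le_bound (Real.sqrt_nonneg _) fun v => ?_
    rw [multilinearOfCoeff_apply]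
    have h1 : ‖∑ i, c i * ∏ k, v k (i k)‖ ≤ ∑ i, ‖c i‖ * ∏ k, ‖v k (i k)‖ :=
      (norm_sum_le _ _).trans_eq (by simp)
    refine h1.trans ((Real.sum_mul_le_sqrt_mul_sqrt _ _ _).trans_eq ?_)
    simp_rw [← Finset.prod_pow]
    rw [sum_prod_norm_sq, Finset.prod_pow, Real.sqrt_sq (by positivity)]
  calc _ ≤ √(∑ i, ‖c i‖ ^ 2) ^ 2 := by gcongr
    _ = _ := Real.sq_sqrt (by positivity)

end Homogeneous

/-! ### Power series of the transformed exponentials -/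

section PowerSeries

variable {d : ℕ}

/-- The exponential `ξ ↦ e^{2πi z·ξ}` with complex frequency `z ∈ ℂ^d`. -/
noncomputable def cexpVec (z : EuclideanSpace ℂ (Fin d)) (ξ : EuclideanSpace ℝ (Fin d)) : ℂ :=
  Complex.exp (2 * Real.pi * Complex.I * ∑ j, z j * ξ j)

lemma cexpVec_complexVec (x ξ : EuclideanSpace ℝ (Fin d)) :
    cexpVec (complexVec x) ξ = character ξ x := by
  rw [cexpVec, character, PiLp.inner_apply]
  congr 1
  simp only [complexVec_apply, RCLike.inner_apply, conj_trivial]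
  push_cast
  rw [Finset.sum_congr rfl fun j _ => mul_comm (x j : ℂ) (ξ j : ℂ)]
  ring

lemma norm_complexVec (x : EuclideanSpace ℝ (Fin d)) : ‖complexVec x‖ = ‖x‖ := by
  rw [EuclideanSpace.norm_eq, EuclideanSpace.norm_eq]; simp

/-- The coefficient of `∏ k, w (i k)` in the expansion of `e^{2πi (x + w)·ξ}` in powers of `w`. -/
noncomputable def expCoeff (x : EuclideanSpace ℝ (Fin d)) {n : ℕ} (i : Fin n → Fin d)
    (ξ : EuclideanSpace ℝ (Fin d)) : ℂ :=
  character ξ x * ((2 * Real.pi * Complex.I) ^ n / n.factorial) * ∏ k, (ξ (i k) : ℂ)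

lemma sum_expCoeff (x : EuclideanSpace ℝ (Fin d)) (n : ℕ) (w : EuclideanSpace ℂ (Fin d))
    (ξ : EuclideanSpace ℝ (Fin d)) :
    ∑ i : Fin n → Fin d, (∏ k, w (i k)) * expCoeff x i ξ =
      character ξ x * ((2 * Real.pi * Complex.I * ∑ j, w j * ξ j) ^ n / n.factorial) := by
  have h : (∑ j, w j * ξ j) ^ n = ∑ i : Fin n → Fin d, ∏ k, (w (i k) * ξ (i k)) := by
    rw [← Fin.prod_const, Finset.prod_univ_sum]; simp
  rw [mul_pow, h, mul_div_right_comm, Finset.mul_sum, Finset.mul_sum]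
  refine Finset.sum_congr rfl fun i _ => ?_
  rw [expCoeff, Finset.prod_mul_distrib]
  ring

lemma hasSum_expCoeff (x : EuclideanSpace ℝ (Fin d)) (w : EuclideanSpace ℂ (Fin d))
    (ξ : EuclideanSpace ℝ (Fin d)) :
    HasSum (fun n => ∑ i : Fin n → Fin d, (∏ k, w (i k)) * expCoeff x i ξ)
      (cexpVec (complexVec x + w) ξ) := by
  simp only [sum_expCoeff]
  have h : cexpVec (complexVec x + w) ξ =
      character ξ x * Complex.exp (2 * Real.pi * Complex.I * ∑ j, w j * ξ j) := by
    rw [← cexpVec_complexVec, cexpVec, cexpVec, ← Complex.exp_add]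
    congr 1
    simp only [PiLp.add_apply, add_mul, Finset.sum_add_distrib]
    ring
  rw [h]
  refine HasSum.mul_left _ ?_
  rw [Complex.exp_eq_exp_ℂ]
  exact NormedSpace.expSeries_div_hasSum_exp _

lemma sum_norm_expCoeff_sq (x : EuclideanSpace ℝ (Fin d)) (n : ℕ) (ξ : EuclideanSpace ℝ (Fin d)) :
    ∑ i : Fin n → Fin d, ‖expCoeff x i ξ‖ ^ 2 = ((2 * Real.pi * ‖ξ‖) ^ n / n.factorial) ^ 2 := by
  have h := sum_prod_norm_sq fun _ : Fin n => complexVec ξ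
  simp only [complexVec_apply, norm_complexVec, Fin.prod_const] at h
  have h2 : ∀ i : Fin n → Fin d, ‖expCoeff x i ξ‖ ^ 2 =
      ((2 * Real.pi) ^ n / n.factorial) ^ 2 * ∏ k, ‖(ξ (i k) : ℂ)‖ ^ 2 := by
    intro i
    rw [expCoeff, norm_mul, norm_mul, norm_character, norm_prod, Finset.prod_pow]
    simp [abs_of_pos Real.pi_pos]
    ring
  simp only [h2]
  rw [← Finset.mul_sum, h]
  ring

variable {a : ℝ} {μ : Measure (EuclideanSpace ℝ (Fin d))}

lemma pow_div_factorial_sq_le (ha : 0 < a) (n : ℕ) {t : ℝ} (ht : 0 ≤ t) :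
    ((2 * Real.pi * t) ^ n / n.factorial) ^ 2 ≤
      (a⁻¹ ^ 2) ^ n * Real.exp (4 * Real.pi * a * t) := by
  have h1 : (2 * Real.pi * a * t) ^ n / n.factorial ≤ Real.exp (2 * Real.pi * a * t) :=
    Real.pow_div_factorial_le_exp _ (by positivity) n
  have h2 : (2 * Real.pi * t) ^ n / n.factorial =
      a⁻¹ ^ n * ((2 * Real.pi * a * t) ^ n / n.factorial) := by
    rw [← mul_div_assoc, ← mul_pow]
    congr 2; field_simp
  rw [h2, mul_pow, ← pow_mul, ← pow_mul, mul_comm n 2]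
  have h3 : Real.exp (4 * Real.pi * a * t) = Real.exp (2 * Real.pi * a * t) ^ 2 := by
    rw [← Real.exp_nat_mul]; congr 1; push_cast; ring
  rw [h3]
  gcongr

lemma memLp_expCoeff (ha : 0 < a)
    (hM : Integrable (fun ξ => Real.exp (4 * Real.pi * a * ‖ξ‖)) μ)
    (x : EuclideanSpace ℝ (Fin d)) {n : ℕ} (i : Fin n → Fin d) :
    MemLp (expCoeff x i) 2 μ := by
  have hc : Continuous (expCoeff x i) := by
    unfold expCoeff
    exact ((continuous_character_left x).mul continuous_const).mul (by fun_prop)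
  rw [memLp_two_iff_integrable_sq_norm hc.aestronglyMeasurable]
  refine (hM.const_mul ((a⁻¹ ^ 2) ^ n)).mono' (by fun_prop)
    (Filter.Eventually.of_forall fun ξ => ?_)
  rw [Real.norm_of_nonneg (by positivity)]
  refine le_trans ?_ (pow_div_factorial_sq_le ha n (norm_nonneg ξ))
  rw [← sum_norm_expCoeff_sq x]
  exact Finset.single_le_sum (f := fun i : Fin n → Fin d => ‖expCoeff x i ξ‖ ^ 2)
    (fun _ _ => by positivity) (Finset.mem_univ i)

/-- `expCoeff x i` as an element of `L²(μ)`. -/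
noncomputable def expCoeffL2 (ha : 0 < a)
    (hM : Integrable (fun ξ => Real.exp (4 * Real.pi * a * ‖ξ‖)) μ)
    (x : EuclideanSpace ℝ (Fin d)) {n : ℕ} (i : Fin n → Fin d) : Lp ℂ 2 μ :=
  (memLp_expCoeff ha hM x i).toLp _

lemma coeFn_expCoeffL2 (ha : 0 < a)
    (hM : Integrable (fun ξ => Real.exp (4 * Real.pi * a * ‖ξ‖)) μ)
    (x : EuclideanSpace ℝ (Fin d)) {n : ℕ} (i : Fin n → Fin d) :
    expCoeffL2 ha hM x i =ᵐ[μ] expCoeff x i :=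
  MemLp.coeFn_toLp _

lemma sum_norm_expCoeffL2_sq_le (ha : 0 < a)
    (hM : Integrable (fun ξ => Real.exp (4 * Real.pi * a * ‖ξ‖)) μ)
    (x : EuclideanSpace ℝ (Fin d)) (n : ℕ) :
    ∑ i : Fin n → Fin d, ‖expCoeffL2 ha hM x i‖ ^ 2 ≤
      (a⁻¹ ^ 2) ^ n * ∫ ξ, Real.exp (4 * Real.pi * a * ‖ξ‖) ∂μ := by
  simp only [← integral_norm_sq_eq_norm_sq]
  rw [← integral_finsetSum _ fun i _ => integrable_norm_sq _, ← integral_const_mul]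
  refine integral_mono_ae (integrable_finsetSum _ fun i _ => integrable_norm_sq _)
    (hM.const_mul _) ?_
  have h : ∀ᵐ ξ ∂μ, ∀ i : Fin n → Fin d, expCoeffL2 ha hM x i ξ = expCoeff x i ξ :=
    ae_all_iff.2 fun i => coeFn_expCoeffL2 ha hM x i
  filter_upwards [h] with ξ hξ
  simp only [hξ, sum_norm_expCoeff_sq]
  exact pow_div_factorial_sq_le ha n (norm_nonneg ξ)

variable (S : Lp ℂ 2 μ →L[ℂ] Lp ℂ 2 μ)

/-- The power series around the real point `x` of the image under `S` of the exponentials, evaluated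
at `ξ`. -/
noncomputable def imageSeries (ha : 0 < a)
    (hM : Integrable (fun ξ => Real.exp (4 * Real.pi * a * ‖ξ‖)) μ)
    (x ξ : EuclideanSpace ℝ (Fin d)) :
    FormalMultilinearSeries ℂ (EuclideanSpace ℂ (Fin d)) ℂ := fun _ =>
  multilinearOfCoeff fun i => S (expCoeffL2 ha hM x i) ξ

/-- Almost every power series converges on the ball of radius `a`: the squares of its coefficients
have integrals of order `a^{-2n}`. -/
lemma ae_le_radius_imageSeries (ha : 0 < a)
    (hM : Integrable (fun ξ => Real.exp (4 * Real.pi * a * ‖ξ‖)) μ)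
    (x : EuclideanSpace ℝ (Fin d)) :
    ∀ᵐ ξ ∂μ, ENNReal.ofReal a ≤ (imageSeries S ha hM x ξ).radius := by
  have key : ∀ r : NNReal, (r : ℝ) < a →
      ∀ᵐ ξ ∂μ, (r : ENNReal) ≤ (imageSeries S ha hM x ξ).radius := by
    intro r hr
    set I := ∫ ξ, Real.exp (4 * Real.pi * a * ‖ξ‖) ∂μ with hI
    have hint : ∀ n, Integrable (fun ξ => (∑ i : Fin n → Fin d,
        ‖S (expCoeffL2 ha hM x i) ξ‖ ^ 2) * (r ^ 2 : ℝ) ^ n) μ := fun n =>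
      (integrable_finsetSum _ fun i _ => integrable_norm_sq _).mul_const _
    have hle : ∀ n, ∫ ξ, (∑ i : Fin n → Fin d,
        ‖S (expCoeffL2 ha hM x i) ξ‖ ^ 2) * (r ^ 2 : ℝ) ^ n ∂μ ≤
        (‖S‖ ^ 2 * I) * ((r / a) ^ 2) ^ n := by
      intro n
      rw [integral_mul_const, integral_finsetSum _ fun i _ => integrable_norm_sq _]
      simp only [integral_norm_sq_eq_norm_sq]
      have h1 : ∑ i : Fin n → Fin d, ‖S (expCoeffL2 ha hM x i)‖ ^ 2 ≤
          ‖S‖ ^ 2 * ((a⁻¹ ^ 2) ^ n * I) := by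
        refine le_trans ?_ (mul_le_mul_of_nonneg_left (sum_norm_expCoeffL2_sq_le ha hM x n)
          (sq_nonneg _))
        rw [Finset.mul_sum]
        refine Finset.sum_le_sum fun i _ => ?_
        rw [← mul_pow]
        exact pow_le_pow_left₀ (norm_nonneg _) (S.le_opNorm _) 2
      refine (mul_le_mul_of_nonneg_right h1 (by positivity)).trans_eq ?_
      rw [div_eq_mul_inv, mul_pow, mul_pow]
      ring
    have hs : Summable fun n : ℕ => (‖S‖ ^ 2 * I) * ((r / a) ^ 2) ^ n := by
      refine (summable_geometric_of_lt_one (by positivity) ?_).mul_left _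
      have : (r : ℝ) / a < 1 := (div_lt_one ha).2 hr
      exact pow_lt_one₀ (by positivity) this two_ne_zero
    filter_upwards [ae_summable_of_summable_integral hint (fun n ξ => by positivity)
      (Summable.of_nonneg_of_le (fun n => integral_nonneg fun ξ => by positivity) hle hs)] with ξ hξ
    obtain ⟨C, hC⟩ := hξ.tendsto_atTop_zero.bddAbove_range
    refine FormalMultilinearSeries.le_radius_of_bound _ √C fun n => Real.le_sqrt_of_sq_le ?_
    refine le_trans ?_ (hC ⟨n, rfl⟩)
    rw [mul_pow, ← pow_mul, mul_comm n 2, pow_mul]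
    exact mul_le_mul_of_nonneg_right (norm_multilinearOfCoeff_sq_le _) (by positivity)
  have hlim : Filter.Tendsto (fun m : ℕ => a - a / ((m : ℝ) + 1)) Filter.atTop (nhds a) := by
    have := (tendsto_const_div_atTop_nhds_zero_nat a).comp (Filter.tendsto_add_atTop_nat 1)
    simpa [Function.comp_def] using this.const_sub a
  have hall : ∀ᵐ ξ ∂μ, ∀ m : ℕ, ENNReal.ofReal (a - a / ((m : ℝ) + 1)) ≤
      (imageSeries S ha hM x ξ).radius := by
    refine ae_all_iff.2 fun m => key _ ?_
    rw [Real.coe_toNNReal']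
    exact max_lt (by linarith [show 0 < a / ((m : ℝ) + 1) by positivity]) ha
  filter_upwards [hall] with ξ hξ
  exact le_of_tendsto' (ENNReal.tendsto_ofReal hlim) hξ

/-- The sum of the power series at `w` is the value of `S e_{x+w}` at `ξ`, for almost every `ξ`. -/
lemma exists_ae_sum_imageSeries_eq (ha : 0 < a)
    (hM : Integrable (fun ξ => Real.exp (4 * Real.pi * a * ‖ξ‖)) μ)
    (x : EuclideanSpace ℝ (Fin d)) {w : EuclideanSpace ℂ (Fin d)} (hw : ‖w‖ < a) :
    ∃ T : Lp ℂ 2 μ, T =ᵐ[μ] cexpVec (complexVec x + w) ∧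
      ∀ᵐ ξ ∂μ, (imageSeries S ha hM x ξ).sum w = S T ξ := by
  have hB : MemLp (fun ξ : EuclideanSpace ℝ (Fin d) => Real.exp (2 * Real.pi * a * ‖ξ‖)) 2 μ := by
    rw [memLp_two_iff_integrable_sq (by fun_prop)]
    refine hM.congr (Filter.Eventually.of_forall fun ξ => ?_)
    simp only
    rw [← Real.exp_nat_mul]; congr 1; push_cast; ring
  set t : ℕ → Lp ℂ 2 μ := fun n => ∑ i : Fin n → Fin d, (∏ k, w (i k)) • expCoeffL2 ha hM x i
    with ht
  have hcoe : ∀ n, ∀ (V : (Fin n → Fin d) → Lp ℂ 2 μ), ∀ᵐ ξ ∂μ,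
      (∑ i : Fin n → Fin d, (∏ k, w (i k)) • V i : Lp ℂ 2 μ) ξ =
        ∑ i : Fin n → Fin d, (∏ k, w (i k)) * V i ξ := by
    intro n V
    have h1 : ∀ᵐ ξ ∂μ, ∀ i, ((∏ k, w (i k)) • V i : Lp ℂ 2 μ) ξ = (∏ k, w (i k)) * V i ξ :=
      ae_all_iff.2 fun i => Lp.coeFn_smul _ _
    filter_upwards [Lp.coeFn_fun_finsetSum Finset.univ
      fun i : Fin n → Fin d => (∏ k, w (i k)) • V i, h1] with ξ h2 h3
    rw [h2]
    exact Finset.sum_congr rfl fun i _ => h3 i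
  have htv : ∀ᵐ ξ ∂μ, ∀ n, t n ξ = ∑ i : Fin n → Fin d, (∏ k, w (i k)) * expCoeff x i ξ := by
    refine ae_all_iff.2 fun n => ?_
    have h1 : ∀ᵐ ξ ∂μ, ∀ i : Fin n → Fin d, expCoeffL2 ha hM x i ξ = expCoeff x i ξ :=
      ae_all_iff.2 fun i => coeFn_expCoeffL2 ha hM x i
    filter_upwards [hcoe n fun i => expCoeffL2 ha hM x i, h1] with ξ h2 h3
    rw [ht, h2]
    simp only [h3]
  have htn : ∀ n, ‖t n‖ ≤ (‖w‖ / a) ^ n * ‖hB.toLp _‖ := by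
    intro n
    refine Lp.norm_le_mul_norm_of_ae_le_mul ?_
    filter_upwards [htv, hB.coeFn_toLp] with ξ h1 h2
    rw [h1, h2, Real.norm_of_nonneg (Real.exp_pos _).le, sum_expCoeff, norm_mul, norm_character,
      one_mul, norm_div, norm_pow, norm_mul]
    have h3 : ‖∑ j, w j * (ξ j : ℂ)‖ ≤ ‖w‖ * ‖ξ‖ := by
      have h6 : ∑ j, w j * (ξ j : ℂ) = inner ℂ (complexVec ξ) w := by
        simp [PiLp.inner_apply]
      rw [h6, mul_comm, ← norm_complexVec ξ]
      exact norm_inner_le_norm _ _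
    have h4 : ‖(2 * Real.pi * Complex.I : ℂ)‖ = 2 * Real.pi := by
      simp [abs_of_pos Real.pi_pos]
    have h5 := Real.pow_div_factorial_le_exp (2 * Real.pi * a * ‖ξ‖) (by positivity) n
    rw [h4, Complex.norm_natCast]
    calc _ ≤ (2 * Real.pi * (‖w‖ * ‖ξ‖)) ^ n / n.factorial := by gcongr
      _ = (‖w‖ / a) ^ n * ((2 * Real.pi * a * ‖ξ‖) ^ n / n.factorial) := by
        rw [← mul_div_assoc, ← mul_pow]; congr 2; field_simp
      _ ≤ _ := by gcongr
  have hgeo : Summable fun n : ℕ => (‖w‖ / a) ^ n :=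
    summable_geometric_of_lt_one (by positivity) ((div_lt_one ha).2 hw)
  have hts : Summable fun n => ‖t n‖ :=
    Summable.of_nonneg_of_le (fun _ => norm_nonneg _) htn (hgeo.mul_right _)
  have hSts : Summable fun n => ‖S (t n)‖ :=
    Summable.of_nonneg_of_le (fun _ => norm_nonneg _) (fun n => S.le_opNorm _) (hts.mul_left _)
  refine ⟨∑' n, t n, ?_, ?_⟩
  · filter_upwards [ae_hasSum_of_summable_norm hts, htv] with ξ h1 h2
    simp only [h2] at h1
    exact h1.unique (hasSum_expCoeff x w ξ)
  · have hSt : ∀ᵐ ξ ∂μ, ∀ n, S (t n) ξ =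
        ∑ i : Fin n → Fin d, (∏ k, w (i k)) * S (expCoeffL2 ha hM x i) ξ := by
      refine ae_all_iff.2 fun n => ?_
      filter_upwards [hcoe n fun i => S (expCoeffL2 ha hM x i)] with ξ h1
      rw [← h1, ht]
      simp only [map_sum, map_smul]
    rw [S.map_tsum hts.of_norm]
    filter_upwards [ae_hasSum_of_summable_norm hSts, hSt] with ξ h1 h2
    rw [← h1.tsum_eq, FormalMultilinearSeries.sum]
    refine tsum_congr fun n => ?_
    rw [h2, imageSeries, multilinearOfCoeff_apply]
    exact Finset.sum_congr rfl fun i _ => mul_comm _ _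

end PowerSeries

/-! ### Gluing the power series and the conclusion -/

section Gluing

variable {d : ℕ} {a : ℝ}

lemma differentiableOn_sum_sub {p : FormalMultilinearSeries ℂ (EuclideanSpace ℂ (Fin d)) ℂ}
    (hp : ENNReal.ofReal a ≤ p.radius) (c : EuclideanSpace ℂ (Fin d)) :
    DifferentiableOn ℂ (fun z => p.sum (z - c)) (Metric.ball c a) := by
  rcases le_or_gt a 0 with ha | ha
  · rw [Metric.ball_eq_empty.2 ha]; exact differentiableOn_empty
  have h := (p.hasFPowerSeriesOnBall ((ENNReal.ofReal_pos.2 ha).trans_le hp)).differentiableOn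
  refine h.comp (by fun_prop) fun z hz => ?_
  refine Metric.eball_subset_eball hp ?_
  rw [Metric.eball_ofReal]
  simpa [dist_eq_norm] using hz

/-- Functions that are holomorphic on the balls of a cover of the tube and agree on a common dense
sequence of points glue to a holomorphic function on the tube. -/
lemma exists_glued {c : ℕ → EuclideanSpace ℂ (Fin d)} {g : ℕ → EuclideanSpace ℂ (Fin d) → ℂ}
    {ζ : ℕ → EuclideanSpace ℂ (Fin d)} (hζ : DenseRange ζ)
    (hcov : ∀ z ∈ tube d a, ∃ m, z ∈ Metric.ball (c m) a)
    (hg : ∀ m, DifferentiableOn ℂ (g m) (Metric.ball (c m) a))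
    (hcompat : ∀ m l j, ζ j ∈ Metric.ball (c m) a → ζ j ∈ Metric.ball (c l) a →
      g m (ζ j) = g l (ζ j)) :
    ∃ G : EuclideanSpace ℂ (Fin d) → ℂ, DifferentiableOn ℂ G (tube d a) ∧
      ∀ m, ∀ z ∈ Metric.ball (c m) a, G z = g m z := by
  have hagree : ∀ m l z, z ∈ Metric.ball (c m) a → z ∈ Metric.ball (c l) a → g m z = g l z := by
    intro m l z hm hl
    by_contra hne
    have hopen : IsOpen ((Metric.ball (c m) a ∩ Metric.ball (c l) a) ∩
        (fun z => g m z - g l z) ⁻¹' {0}ᶜ) :=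
      (((hg m).continuousOn.mono Set.inter_subset_left).sub
        ((hg l).continuousOn.mono Set.inter_subset_right)).isOpen_inter_preimage
        (Metric.isOpen_ball.inter Metric.isOpen_ball) isOpen_compl_singleton
    obtain ⟨j, hj⟩ := hζ.exists_mem_open hopen ⟨z, ⟨hm, hl⟩, sub_ne_zero.2 hne⟩
    exact hj.2 (sub_eq_zero.2 (hcompat m l j hj.1.1 hj.1.2))
  classical
  refine ⟨fun z => if h : ∃ m, z ∈ Metric.ball (c m) a then g h.choose z else 0, ?_, ?_⟩
  · intro z hz
    obtain ⟨m, hm⟩ := hcov z hz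
    have hnhds := Metric.isOpen_ball.mem_nhds hm
    refine DifferentiableAt.differentiableWithinAt ?_
    refine ((hg m).differentiableAt hnhds).congr_of_eventuallyEq ?_
    filter_upwards [hnhds] with w hw
    have h : ∃ m, w ∈ Metric.ball (c m) a := ⟨m, hw⟩
    rw [dif_pos h]
    exact hagree _ _ _ h.choose_spec hw
  · intro m z hz
    have h : ∃ m, z ∈ Metric.ball (c m) a := ⟨m, hz⟩
    simp only [dif_pos h]
    exact hagree _ _ _ h.choose_spec hz

lemma exists_mem_ball_complexVec {q : ℕ → EuclideanSpace ℝ (Fin d)} (hq : DenseRange q)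
    {z : EuclideanSpace ℂ (Fin d)} (hz : z ∈ tube d a) :
    ∃ m, z ∈ Metric.ball (complexVec (q m)) a := by
  have hopen : IsOpen {x : EuclideanSpace ℝ (Fin d) | dist z (complexVec x) < a} :=
    isOpen_lt (continuous_const.dist continuous_complexVec) continuous_const
  refine hq.exists_mem_open hopen ⟨reVec z, ?_⟩
  have h : z - complexVec (reVec z) = Complex.I • complexVec (imVec z) := by
    rw [sub_eq_iff_eq_add', complexVec_reVec_add]
  change dist z (complexVec (reVec z)) < a
  rw [dist_eq_norm, h, norm_smul, norm_complexVec]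
  simpa [tube] using hz

/-- If a bounded operator on `L²(μ)` maps `e^{2πi q·ξ}` to `e^{2πi f(q)·ξ}` for all `q` in a
countable set `D`, then for almost every `ξ` the function `q ↦ e^{2πi f(q)·ξ}` on `D` extends
holomorphically to the tube. -/
theorem ae_exists_isExtension (ha : 0 < a) {μ : Measure (EuclideanSpace ℝ (Fin d))}
    [IsFiniteMeasure μ] (hM : Integrable (fun ξ => Real.exp (4 * Real.pi * a * ‖ξ‖)) μ)
    (S : Lp ℂ 2 μ →L[ℂ] Lp ℂ 2 μ) {D : Set (EuclideanSpace ℝ (Fin d))} (hD : D.Countable)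
    {f : EuclideanSpace ℝ (Fin d) → EuclideanSpace ℝ (Fin d)}
    (hS : ∀ q ∈ D, S (charL2 μ q) = charL2 μ (f q)) :
    ∀ᵐ ξ ∂μ, ∃ g, IsExtension a D f ξ g := by
  set q := TopologicalSpace.denseSeq (EuclideanSpace ℝ (Fin d)) with hqdef
  set ζ := TopologicalSpace.denseSeq (EuclideanSpace ℂ (Fin d)) with hζdef
  have hq : DenseRange q := TopologicalSpace.denseRange_denseSeq _
  have hζ : DenseRange ζ := TopologicalSpace.denseRange_denseSeq _
  -- near each real point the series represents the image of one and the same element of `L²(μ)`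
  have hval : ∀ m z, z ∈ Metric.ball (complexVec (q m)) a → ∃ T : Lp ℂ 2 μ, T =ᵐ[μ] cexpVec z ∧
      ∀ᵐ ξ ∂μ, (imageSeries S ha hM (q m) ξ).sum (z - complexVec (q m)) = S T ξ := by
    intro m z hz
    rw [Metric.mem_ball, dist_eq_norm] at hz
    have := exists_ae_sum_imageSeries_eq S ha hM (q m) hz
    rwa [add_sub_cancel] at this
  have hrad : ∀ᵐ ξ ∂μ, ∀ m, ENNReal.ofReal a ≤ (imageSeries S ha hM (q m) ξ).radius :=
    ae_all_iff.2 fun m => ae_le_radius_imageSeries S ha hM (q m)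
  have hcompat : ∀ᵐ ξ ∂μ, ∀ m l j, ζ j ∈ Metric.ball (complexVec (q m)) a →
      ζ j ∈ Metric.ball (complexVec (q l)) a →
      (imageSeries S ha hM (q m) ξ).sum (ζ j - complexVec (q m)) =
        (imageSeries S ha hM (q l) ξ).sum (ζ j - complexVec (q l)) := by
    simp only [ae_all_iff]
    intro m l j hm hl
    obtain ⟨T, hT, h1⟩ := hval m _ hm
    obtain ⟨T', hT', h2⟩ := hval l _ hl
    have hTT : T = T' := Lp.ext (hT.trans hT'.symm)
    filter_upwards [h1, h2] with ξ h1 h2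
    rw [h1, h2, hTT]
  have hpt : ∀ᵐ ξ ∂μ, ∀ x ∈ D, ∀ m, complexVec x ∈ Metric.ball (complexVec (q m)) a →
      (imageSeries S ha hM (q m) ξ).sum (complexVec x - complexVec (q m)) =
        character ξ (f x) := by
    rw [ae_ball_iff hD]
    simp only [ae_all_iff]
    intro x hx m hm
    obtain ⟨T, hT, h1⟩ := hval m _ hm
    have hTx : T = charL2 μ x := by
      refine Lp.ext ?_
      filter_upwards [hT, coeFn_charL2 μ x] with ξ h2 h3
      rw [h2, h3, cexpVec_complexVec]
    filter_upwards [h1, coeFn_charL2 μ (f x)] with ξ h2 h3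
    rw [h2, hTx, hS x hx, h3]
  filter_upwards [hrad, hcompat, hpt] with ξ h1 h2 h3
  obtain ⟨G, hG, hGm⟩ := exists_glued hζ (fun z hz => exists_mem_ball_complexVec hq hz)
    (fun m => differentiableOn_sum_sub (h1 m) (complexVec (q m))) h2
  refine ⟨G, hG, fun x hx => ?_⟩
  obtain ⟨m, hm⟩ := exists_mem_ball_complexVec hq (complexVec_mem_tube ha x)
  rw [hGm m _ hm, h3 x hx m hm]

end Gluing

theorem mainTheorem3 {d : ℕ} (u : EuclideanSpace ℝ (Fin d) → ℂ)
    (hu_cont : Continuous u) (hu_L2 : MemLp u 2 volume) (hu_ne : u ≠ 0)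
    (hu_pd : IsPositiveDefiniteKernel fun x y => u (x - y))
    (hu_hat_L1 : MemLp (fourierL2 u hu_L2) 1 volume)
    (hu_hat_Linf : MemLp (fourierL2 u hu_L2) ⊤ volume)
    (n : ℕ) (hn : 0 < n) (a : ℝ) (ha : 0 < a)
    (hDC : DecayCondition n a (fourierL2 u hu_L2))
    (U : Set (EuclideanSpace ℝ (Fin d))) (hU : IsOpen U)
    (f : U → EuclideanSpace ℝ (Fin d))
    (hdom : (compositionOperator hu_pd.Space (hu_pd.restrict U).Space f).domain = ⊤)
    (hbdd : IsBoundedOperator (compositionOperator hu_pd.Space (hu_pd.restrict U).Space f)) :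
    ∃ F : EuclideanSpace ℂ (Fin d) → EuclideanSpace ℂ (Fin d),
      DifferentiableOn ℂ F (tube d a) ∧ ∀ x : U, F (complexVec x) = complexVec (f x) := by
  classical
  rcases U.eq_empty_or_nonempty with hempty | hne
  · exact ⟨fun _ => 0, differentiableOn_const _, fun x => absurd x.2 (by simp [hempty])⟩
  obtain ⟨μ, hfin, hac, hμ0, hM, hrep⟩ :=
    exists_spectralMeasure hu_cont hu_L2 hu_ne hu_pd hu_hat_L1 hu_hat_Linf hDC
  obtain ⟨S, hS⟩ := exists_operator_charL2 hu_pd hdom hbdd μ hrep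
  set f' : EuclideanSpace ℝ (Fin d) → EuclideanSpace ℝ (Fin d) :=
    fun x => if h : x ∈ U then f ⟨x, h⟩ else 0 with hf'
  have hf'U : ∀ x : U, f' x = f x := fun x => by simp [hf']
  have main : ∀ D : Set (EuclideanSpace ℝ (Fin d)), D.Countable → D ⊆ U → U ⊆ closure D →
      ∃ F : EuclideanSpace ℂ (Fin d) → EuclideanSpace ℂ (Fin d),
        DifferentiableOn ℂ F (tube d a) ∧ ∀ x ∈ D, F (complexVec x) = complexVec (f' x) := by
    intro D hDc hDU hUD
    have hae := ae_exists_isExtension ha hM S hDc (f := f') fun q hq => by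
      rw [hS ⟨q, hDU hq⟩, ← hf'U]
    set E := (toMeasurable μ {ξ | ¬ ∃ g, IsExtension a D f' ξ g})ᶜ with hE
    have hEm : MeasurableSet E := (measurableSet_toMeasurable _ _).compl
    have hEμ : μ Eᶜ = 0 := by
      rw [hE, compl_compl, measure_toMeasurable]; exact hae
    have hpos : 0 < volume E := by
      refine pos_iff_ne_zero.2 fun h0 => hμ0 ?_
      rw [← Measure.measure_univ_eq_zero, ← Set.union_compl_self E]
      exact measure_union_null (hac h0) hEμ
    refine exists_extension_of_pos_measure ha hU hne hUD hEm hpos fun ξ hξ => ?_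
    by_contra hcon
    exact hξ (subset_toMeasurable _ _ hcon)
  set D₀ := U ∩ Set.range (TopologicalSpace.denseSeq (EuclideanSpace ℝ (Fin d))) with hD₀
  have hD₀c : D₀.Countable := (Set.countable_range _).mono Set.inter_subset_right
  have hUD₀ : U ⊆ closure D₀ :=
    (TopologicalSpace.denseRange_denseSeq _).open_subset_closure_inter hU
  obtain ⟨F, hF, hFx⟩ := main D₀ hD₀c Set.inter_subset_left hUD₀
  refine ⟨F, hF, fun x => ?_⟩
  -- `f` is not known to be continuous: the extension for `D₀ ∪ {x}` coincides with `F`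
  obtain ⟨G, hG, hGx⟩ := main (insert (x : EuclideanSpace ℝ (Fin d)) D₀) (hD₀c.insert _)
    (Set.insert_subset x.2 Set.inter_subset_left)
    (hUD₀.trans (closure_mono (Set.subset_insert _ _)))
  have hFG : F (complexVec x) = G (complexVec x) := by
    ext i
    refine eqOn_tube (differentiableOn_euclidean.1 hF i) (differentiableOn_euclidean.1 hG i) hU hne
      hUD₀ (fun y hy => ?_) _ (complexVec_mem_tube ha _)
    rw [hFx y hy, hGx y (Set.mem_insert_of_mem _ hy)]
  rw [hFG, hGx x (Set.mem_insert _ _), hf'U]
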